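/- **Conventions.** Write $x^\perp=(-x_2,x_1)$ for $x\in\mathbb R^2$. Let $\mu>0$ and let $\mathbf e_1,\mathbf e_2\in\mathbb R^2$ be positively oriented, $\det(\mathbf e_1,\mathbf e_2)>0$. Write points as $x=a\,\mathbf e_1+b\,\mathbf e_2$. The unit cell is $\mathcal U=\{|a|,|b|\le\frac12\}$ and the expanded cell is $\tilde{\mathcal U}=\{-1\le a,b<1\}$. The walls $D=\{b=-\frac12,|a|\le\frac12\}$, $L=\{a=-\frac12,|b|\le\frac12\}$, $R=L+\mathbf e_1$ and their translates are directed along $\mathbf e_1$ (for $D$) and $\mathbf e_2$ (for $L$, $R$). On every directed curve with unit tangent $\mathbf t$ tractions are taken with respect to the unit normal $\mathbf n=\mathbf t^\perp$. For a velocity–pressure pair, $\mathbf T(\mathbf v,q)_i=\sum_j\big(-\delta_{ij}q+\mu(\partial_jv_i+\partial_iv_j)\big)n_j$. With $r=x-y$, the Stokeslet is $G_{ij}(x,y)=\frac1{4\pi\mu}\big(\delta_{ij}\log\frac1{|r|}+\frac{r_ir_j}{|r|^2}\big)$, and for a curve $\Gamma$ with density $\boldsymbol\sigma$ the free-space single-layer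 traction is $$S^t_\Gamma[\boldsymbol\sigma](x)=\int_\Gamma G^t(x,y)\boldsymbol\sigma(y)\,ds_y,\qquad G^t_{ik}(x,y)=-\frac1\pi\frac{r_ir_k}{|r|^2}\frac{r\cdot\mathbf n_x}{|r|^2}.$$ The near sums $S^{near}_\Gamma[\boldsymbol\sigma]$ (velocity) and $S^{near,t}_\Gamma[\boldsymbol\sigma]$ (traction) are obtained by replacing $G(x,y)$, $G^t(x,y)$ by the sums of $G(x,y+m\mathbf e_1+k\mathbf e_2)$, $G^t(x,y+m\mathbf e_1+k\mathbf e_2)$ over the $(m,k)\in\mathbb Z^2$ with $y+m\mathbf e_1+k\mathbf e_2\in\tilde{\mathcal U}$. **Setting.** Let $\Omega$ be a bounded domain with $\overline\Omega\subset\tilde{\mathcal U}$ whose boundary $\Gamma$ is one smooth simple closed curve and whose closure is disjoint from all its translates by non-zero lattice vectors; $\Omega$ may cut the bottom wall $D$. Let $\boldsymbol\sigma$ be a continuous density on $\Gamma$ and $\mathbf F=\int_\Gamma\boldsymbol\sigma\,ds$. Let $(\mathbf v,q)$ be a correction pair: a smooth solution of $-\mu\Delta\mathbf v+\nabla q=0$,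 $\nabla\cdot\mathbf v=0$ in an open convex set $W$ with $\mathcal U\subset W\subset\tilde{\mathcal U}$, such that $S^{near}_\Gamma[\boldsymbol\sigma]+\mathbf v$ takes equal values at corresponding points of opposite walls of $\mathcal U$, and such that $S^{near,t}_\Gamma[\boldsymbol\sigma]+\mathbf T(\mathbf v,q)$, taken with the normals pointing out of $\mathcal U$ at $R$ and at the top wall $U=D+\mathbf e_2$, has the jumps $-\mathbf F/(2|\mathbf e_2|)$ from $L$ to $R$ and $-\mathbf F/(2|\mathbf e_1|)$ from $D$ to $U$ (at wall points not on lattice translates of $\Gamma$). Let $\mathbf T=S^{per,t}_\Gamma[\boldsymbol\sigma]=S^{near,t}_\Gamma[\boldsymbol\sigma]+\mathbf T(\mathbf v,q)$ be the traction of the periodic single-layer potential. Let $\mathcal C\subset W$ be a piecewise $C^1$ curve of finite length with the same initial and final point as $D$, which touches no lattice translate of $\overline\Omega$ and passes below $\Omega$: for the periodic curve $\bigcup_{m\in\mathbb Z}(\mathcal C+m\mathbf e_1)$, the sets $\overline\Omega+k\mathbf e_2$ lie above it for integers $k\ge0$ and below it for $k<0$ (that is, each of their points can be joined, without meeting the periodic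 curve, to a point whose coordinate $b$ is larger, respectively smaller, than on the whole periodic curve). Let $\Gamma_1,\dots,\Gamma_4$ be the parts of $\Gamma$ in the quadrants $\{a\ge0,b\ge0\}$, $\{a<0,b\ge0\}$, $\{a<0,b<0\}$, $\{a\ge0,b<0\}$; put $\tilde\Gamma_1=\Gamma_1-\mathbf e_1-\mathbf e_2$, $\tilde\Gamma_2=\Gamma_2-\mathbf e_2$, $\tilde\Gamma_3=\Gamma_3$, $\tilde\Gamma_4=\Gamma_4-\mathbf e_1$, $\tilde\Gamma=\bigcup_i\tilde\Gamma_i$, and let $\tilde{\boldsymbol\sigma}$ on $\tilde\Gamma$ be the density $\boldsymbol\sigma$ carried along with the pieces. **Proposition.** Then $$\begin{aligned}\int_{\mathcal C}\mathbf T\,ds=&\int_{R-\mathbf e_2}S^t_{\tilde\Gamma}[\tilde{\boldsymbol\sigma}]\,ds-\int_{L-\mathbf e_1-\mathbf e_2}S^t_{\tilde\Gamma}[\tilde{\boldsymbol\sigma}]\,ds+2\int_{D-\mathbf e_1-\mathbf e_2}S^t_{\tilde\Gamma}[\tilde{\boldsymbol\sigma}]\,ds+2\int_{D-\mathbf e_2}S^t_{\tilde\Gamma}[\tilde{\boldsymbol\sigma}]\,ds\\&-\int_{\Gamma_1\cup\Gamma_2}\boldsymbol\sigma\,ds+\int_D\mathbf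 T(\mathbf v,q)\,ds.\end{aligned}$$ Moreover the sources and targets on the right are well separated: for every $x$ on one of the four shifted walls $R-\mathbf e_2$, $L-\mathbf e_1-\mathbf e_2$, $D-\mathbf e_1-\mathbf e_2$, $D-\mathbf e_2$ and every $y\in\tilde\Gamma$, one of the two coordinates of $x-y$ in the basis $(\mathbf e_1,\mathbf e_2)$ has absolute value at least $\frac12$. -/

import Mathlib

open MeasureTheory Set
open scoped ContDiff InnerProductSpace Laplacian Gradient

noncomputable section

namespace StokesCell

/-- The Euclidean plane. -/
abbrev Plane : Type := EuclideanSpace ℝ (Fin 2)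

/-- Rotation by a right angle counterclockwise, `x^⊥ = (-x₂, x₁)`. -/
def perp (x : Plane) : Plane := !₂[-(x 1), x 0]

/-- The determinant of the pair `(x, y)`. -/
def cross (x y : Plane) : ℝ := x 0 * y 1 - x 1 * y 0

/-! ### The skew unit cell centred at the origin -/

/-- The `e₁`-coordinate of `x` in the basis `(e₁, e₂)`. -/
def coordA (e₁ e₂ x : Plane) : ℝ := cross x e₂ / cross e₁ e₂

/-- The `e₂`-coordinate of `x` in the basis `(e₁, e₂)`. -/
def coordB (e₁ e₂ x : Plane) : ℝ := cross e₁ x / cross e₁ e₂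

/-- The closed unit cell. -/
def cell (e₁ e₂ : Plane) : Set Plane :=
  {x | |coordA e₁ e₂ x| ≤ 1 / 2 ∧ |coordB e₁ e₂ x| ≤ 1 / 2}

/-- The expanded cell: same centre, walls parallel to those of the unit cell and twice as long.
It is taken half-open, so that it contains exactly four lattice translates of every point. -/
def expandedCell (e₁ e₂ : Plane) : Set Plane :=
  {x | coordA e₁ e₂ x ∈ Ico (-1 : ℝ) 1 ∧ coordB e₁ e₂ x ∈ Ico (-1 : ℝ) 1}

/-- The lower left corner of the unit cell. -/
def corner (e₁ e₂ : Plane) : Plane := -((1 / 2 : ℝ) • (e₁ + e₂))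

/-- The segment from `a` to `a + d`, as a curve parametrized by `[0, 1]`. -/
def seg (a d : Plane) : ℝ → Plane := fun t => a + t • d

/-- The left wall, directed along `e₂`. -/
def wallL (e₁ e₂ : Plane) : ℝ → Plane := seg (corner e₁ e₂) e₂

/-- The right wall, directed along `e₂`. -/
def wallR (e₁ e₂ : Plane) : ℝ → Plane := seg (corner e₁ e₂ + e₁) e₂

/-- The bottom wall, directed along `e₁`. -/
def wallD (e₁ e₂ : Plane) : ℝ → Plane := seg (corner e₁ e₂) e₁

/-- The translate `c - a` of a parametrized curve. -/
def shiftCurve (c : ℝ → Plane) (a : Plane) : ℝ → Plane := fun t => c t - a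

/-! ### Curves and line integrals of tractions -/

/-- A piecewise `C¹` curve of finite length, parametrized by `[0, 1]`. -/
def IsPiecewiseC1 (c : ℝ → Plane) : Prop :=
  ContinuousOn c (Icc 0 1) ∧
  (∃ P : Set ℝ, P.Finite ∧ ∀ t ∈ Ioo (0 : ℝ) 1 \ P, ContDiffAt ℝ 1 c t) ∧
  IntervalIntegrable (deriv c) volume 0 1

/-- The unit normal of a directed curve: the unit tangent rotated counterclockwise. -/
def unitNormal (c : ℝ → Plane) (t : ℝ) : Plane := perp (‖deriv c t‖⁻¹ • deriv c t)

/-- `∫_c T ds`, for a traction `T x n` at the point `x` with respect to the normal `n`. -/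
def tractionIntegral (c : ℝ → Plane) (T : Plane → Plane → Plane) : Plane :=
  ∫ t in (0 : ℝ)..1, ‖deriv c t‖ • T (c t) (unitNormal c t)

/-! ### Stokes pairs -/

/-- The partial derivative `∂ⱼ uᵢ`. -/
def pderiv (u : Plane → Plane) (j i : Fin 2) (x : Plane) : ℝ :=
  fderiv ℝ u x (EuclideanSpace.single j 1) i

/-- The stress tensor `σᵢⱼ(u, p) = -δᵢⱼ p + μ (∂ⱼuᵢ + ∂ᵢuⱼ)`. -/
def stress (μ : ℝ) (u : Plane → Plane) (p : Plane → ℝ) (x : Plane) : Matrix (Fin 2) (Fin 2) ℝ :=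
  Matrix.of fun i j => (if i = j then -p x else 0) + μ * (pderiv u j i x + pderiv u i j x)

/-- The traction `T(u, p) = σ(u, p) n`. -/
def traction (μ : ℝ) (u : Plane → Plane) (p : Plane → ℝ) (x n : Plane) : Plane :=
  WithLp.toLp 2 fun i => ∑ j, stress μ u p x i j * n j

/-- `(u, p)` is a smooth solution of `-μ Δu + ∇p = 0`, `∇ · u = 0` in the open set `W`. -/
def IsStokesPair (μ : ℝ) (W : Set Plane) (u : Plane → Plane) (p : Plane → ℝ) : Prop :=
  ContDiffOn ℝ ∞ u W ∧ ContDiffOn ℝ ∞ p W ∧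
  ∀ x ∈ W, -(μ • Δ u x) + ∇ p x = 0 ∧ ∑ i, pderiv u i i x = 0

/-! ### Free-space kernels and layer potentials -/

/-- The Stokeslet `G(x, y) f`, where
`Gᵢⱼ(x, y) = (1 / 4πμ) (δᵢⱼ log (1 / |r|) + rᵢ rⱼ / |r|²)` and `r = x - y`. -/
def stokeslet (μ : ℝ) (x y f : Plane) : Plane :=
  (1 / (4 * Real.pi * μ)) •
    (Real.log (1 / ‖x - y‖) • f + (⟪x - y, f⟫_ℝ / ‖x - y‖ ^ 2) • (x - y))

/-- The single-layer traction kernel `Gᵗ(x, y) f` for the normal `n` at the target `x`, where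
`Gᵗᵢₖ(x, y) = -(1 / π) (rᵢ rₖ / |r|²) (r · n / |r|²)` and `r = x - y`. -/
def tractionKernel (x n y f : Plane) : Plane :=
  (-(1 / Real.pi) * (⟪x - y, f⟫_ℝ / ‖x - y‖ ^ 2) * (⟪x - y, n⟫_ℝ / ‖x - y‖ ^ 2)) • (x - y)

/-- `Sᵗ_Γ[σ](x) = ∫_Γ Gᵗ(x, y) σ(y) ds_y`; arc length is one-dimensional Hausdorff measure. -/
def singleLayerTraction (Γ : Set Plane) (σ : Plane → Plane) (x n : Plane) : Plane :=
  ∫ y in Γ, tractionKernel x n y (σ y) ∂μH[1]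

/-- The net force `∫_Γ σ ds`. -/
def netForce (Γ : Set Plane) (σ : Plane → Plane) : Plane := ∫ y in Γ, σ y ∂μH[1]

/-- The lattice vector `m e₁ + k e₂`. -/
def latticeVec (e₁ e₂ : Plane) (m k : ℤ) : Plane := (m : ℝ) • e₁ + (k : ℝ) • e₂

/-- The sum of a kernel over the lattice images of the source that lie in the expanded cell. -/
def nearSum (e₁ e₂ : Plane) (K : Plane → Plane) (y : Plane) : Plane :=
  ∑ᶠ (k : ℤ × ℤ) (_ : y + latticeVec e₁ e₂ k.1 k.2 ∈ expandedCell e₁ e₂),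
    K (y + latticeVec e₁ e₂ k.1 k.2)

/-- The near part of the single-layer velocity. -/
def nearVelocity (μ : ℝ) (e₁ e₂ : Plane) (Γ : Set Plane) (σ : Plane → Plane) (x : Plane) : Plane :=
  ∫ y in Γ, nearSum e₁ e₂ (fun z => stokeslet μ x z (σ y)) y ∂μH[1]

/-- The near part of the single-layer traction. -/
def nearTraction (e₁ e₂ : Plane) (Γ : Set Plane) (σ : Plane → Plane) (x n : Plane) : Plane :=
  ∫ y in Γ, nearSum e₁ e₂ (fun z => tractionKernel x n z (σ y)) y ∂μH[1]

/-- The point `x` lies on no lattice image of `Γ`. -/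
def OffLattice (e₁ e₂ : Plane) (Γ : Set Plane) (x : Plane) : Prop :=
  ∀ m k : ℤ, x + latticeVec e₁ e₂ m k ∉ Γ

/-- `(v, q)` is a correction pair of the periodic single-layer potential on `Γ` with density `σ`:
a Stokes pair in the neighbourhood `W` of the cell, without sources, whose discrepancies between
opposite walls turn the near sum into a velocity without jumps and a traction whose jump across
each pair of opposite walls is constant and carries one half of the net force `F = ∫_Γ σ ds`.
The jumps are those of the tractions for the normals that point out of the cell at the right wall
(`-e₂^⊥/|e₂|`) and at the top wall (`e₁^⊥/|e₁|`), so that the total outward traction is `-F`.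
Wall points that lie on images of `Γ` (where the single-layer traction has no value) are skipped. -/
structure IsCorrectionPair (μ : ℝ) (e₁ e₂ : Plane) (Γ : Set Plane) (σ : Plane → Plane)
    (W : Set Plane) (v : Plane → Plane) (q : Plane → ℝ) : Prop where
  stokes : IsStokesPair μ W v q
  velocity_RL : ∀ t ∈ Icc (0 : ℝ) 1, ∀ x, x = wallL e₁ e₂ t → OffLattice e₁ e₂ Γ x →
    v (x + e₁) - v x = -(nearVelocity μ e₁ e₂ Γ σ (x + e₁) - nearVelocity μ e₁ e₂ Γ σ x)
  traction_RL : ∀ t ∈ Icc (0 : ℝ) 1, ∀ x, x = wallL e₁ e₂ t → OffLattice e₁ e₂ Γ x →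
    ∀ n, n = -(‖e₂‖⁻¹ • perp e₂) →
    traction μ v q (x + e₁) n - traction μ v q x n =
      -(nearTraction e₁ e₂ Γ σ (x + e₁) n - nearTraction e₁ e₂ Γ σ x n)
        - (1 / (2 * ‖e₂‖)) • netForce Γ σ
  velocity_UD : ∀ t ∈ Icc (0 : ℝ) 1, ∀ x, x = wallD e₁ e₂ t → OffLattice e₁ e₂ Γ x →
    v (x + e₂) - v x = -(nearVelocity μ e₁ e₂ Γ σ (x + e₂) - nearVelocity μ e₁ e₂ Γ σ x)
  traction_UD : ∀ t ∈ Icc (0 : ℝ) 1, ∀ x, x = wallD e₁ e₂ t → OffLattice e₁ e₂ Γ x →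
    ∀ n, n = ‖e₁‖⁻¹ • perp e₁ →
    traction μ v q (x + e₂) n - traction μ v q x n =
      -(nearTraction e₁ e₂ Γ σ (x + e₂) n - nearTraction e₁ e₂ Γ σ x n)
        - (1 / (2 * ‖e₁‖)) • netForce Γ σ

/-- The traction `Sᵖᵉʳ'ᵗ_Γ[σ] = Sⁿᵉᵃʳ'ᵗ_Γ[σ] + T(v, q)` of the periodic single-layer potential. -/
def periodicTraction (μ : ℝ) (e₁ e₂ : Plane) (Γ : Set Plane) (σ : Plane → Plane)
    (v : Plane → Plane) (q : Plane → ℝ) (x n : Plane) : Plane :=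
  nearTraction e₁ e₂ Γ σ x n + traction μ v q x n

/-! ### The particle and the deformed contour -/

/-- A smooth simple closed curve. -/
def IsSmoothClosedCurve (Γ : Set Plane) : Prop :=
  ∃ γ : ℝ → Plane, ContDiff ℝ ∞ γ ∧ Function.Periodic γ 1 ∧ (∀ s, deriv γ s ≠ 0) ∧
    InjOn γ (Ico 0 1) ∧ range γ = Γ

/-- A particle: a bounded domain, bounded by one smooth closed curve, contained with its boundary
in the expanded cell and disjoint from its lattice images. -/
structure IsParticle (e₁ e₂ : Plane) (Ω : Set Plane) : Prop where
  isOpen : IsOpen Ω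
  connected : IsConnected Ω
  bounded : Bornology.IsBounded Ω
  boundary : IsSmoothClosedCurve (frontier Ω)
  subset : closure Ω ⊆ expandedCell e₁ e₂
  disjoint_images : ∀ m k : ℤ, (m, k) ≠ (0, 0) → ∀ x ∈ closure Ω,
    x + latticeVec e₁ e₂ m k ∉ closure Ω

/-- The union of all the translates of the curve `c` by integer multiples of `e₁`. -/
def periodicCurve (e₁ : Plane) (c : ℝ → Plane) : Set Plane :=
  {x | ∃ m : ℤ, ∃ t ∈ Icc (0 : ℝ) 1, x = c t + (m : ℝ) • e₁}

/-- `x` can be joined, without meeting the periodic curve generated by `c`, to a point that is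
higher (in the direction of `e₂`) than every point of that curve. -/
def LiesAbove (e₁ e₂ : Plane) (c : ℝ → Plane) (x : Plane) : Prop :=
  ∃ z, JoinedIn (periodicCurve e₁ c)ᶜ x z ∧
    ∀ w ∈ periodicCurve e₁ c, coordB e₁ e₂ w < coordB e₁ e₂ z

/-- `x` can be joined, without meeting the periodic curve generated by `c`, to a point that is
lower (in the direction of `e₂`) than every point of that curve. -/
def LiesBelow (e₁ e₂ : Plane) (c : ℝ → Plane) (x : Plane) : Prop :=
  ∃ z, JoinedIn (periodicCurve e₁ c)ᶜ x z ∧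
    ∀ w ∈ periodicCurve e₁ c, coordB e₁ e₂ z < coordB e₁ e₂ w

/-- `c` is a deformation of the bottom wall, with the same endpoints, that touches no lattice image
of the particle `Ω` and passes below `Ω`: the row of particles of `Ω` and the rows over it lie
above `c`, the rows under it lie below `c`. -/
structure IsDeformedBottomWall (e₁ e₂ : Plane) (Ω : Set Plane) (c : ℝ → Plane) : Prop where
  piecewiseC1 : IsPiecewiseC1 c
  start : c 0 = wallD e₁ e₂ 0
  finish : c 1 = wallD e₁ e₂ 1
  above : ∀ k : ℤ, 0 ≤ k → ∀ x ∈ closure Ω, LiesAbove e₁ e₂ c (x + latticeVec e₁ e₂ 0 k)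
  below : ∀ k : ℤ, k < 0 → ∀ x ∈ closure Ω, LiesBelow e₁ e₂ c (x + latticeVec e₁ e₂ 0 k)

/-! ### The shifted pieces of the boundary -/

/-- The four quadrants of the skew coordinates, numbered `0, 1, 2, 3` counterclockwise. -/
def quadrant (e₁ e₂ : Plane) : Fin 4 → Set Plane :=
  ![{x | 0 ≤ coordA e₁ e₂ x ∧ 0 ≤ coordB e₁ e₂ x},
    {x | coordA e₁ e₂ x < 0 ∧ 0 ≤ coordB e₁ e₂ x},
    {x | coordA e₁ e₂ x < 0 ∧ coordB e₁ e₂ x < 0},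
    {x | 0 ≤ coordA e₁ e₂ x ∧ coordB e₁ e₂ x < 0}]

/-- The piece of `Γ` in the quadrant `i`. -/
def piece (e₁ e₂ : Plane) (Γ : Set Plane) (i : Fin 4) : Set Plane := Γ ∩ quadrant e₁ e₂ i

/-- The vectors subtracted from the four pieces. -/
def pieceShift (e₁ e₂ : Plane) : Fin 4 → Plane := ![e₁ + e₂, e₂, 0, e₁]

/-- The union of the four shifted pieces. -/
def shiftedBoundary (e₁ e₂ : Plane) (Γ : Set Plane) : Set Plane :=
  ⋃ i, (fun y => y - pieceShift e₁ e₂ i) '' piece e₁ e₂ Γ i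

/-- `σ'` on the shifted boundary is the density `σ` carried along with the pieces. -/
def IsShiftedDensity (e₁ e₂ : Plane) (Γ : Set Plane) (σ σ' : Plane → Plane) : Prop :=
  ∀ i, ∀ y ∈ piece e₁ e₂ Γ i, σ' (y - pieceShift e₁ e₂ i) = σ y

end StokesCell

end

open StokesCell

noncomputable section

namespace StokesCell

open Filter Topology

/-! The traction on `c` is the near sum plus $\mathbf T(\mathbf v,q)$. The second part is the
integral of a 1-form that is closed because the stress tensor is divergence free (`div_stress`). In
the convex set $W$ it depends only on the end points, so `c` may be replaced by $D$
(`IsStokesPair.integral_eq`).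

For the near sum, `c` and the walls have positive distance from the sources, so the integrals over
the curve and over $\Gamma$ may be exchanged, and a single force $f$ remains to be treated. With
$r=x-z$ as a complex number, the traction on a line element $dx$ is
$\frac1{2\pi}\,\mathrm{Im}(dx/r)\,(f+\frac r{\bar r}\bar f)$ (`toC_tractionKernel`). Along a curve
the first term integrates to $f/2\pi$ times the variation of the angle seen from $z$. The second
term has the single-valued primitive $\frac{r}{4\pi i\bar r}\bar f$, so only end points matter
(`toC_kernelIntegral`).

Each source has four images in the expanded cell: $z$ in the lower left quadrant, $z+\mathbf e_1$,
$z+\mathbf e_2$ and $z+\mathbf e_1+\mathbf e_2$. Moving the curve instead of the source, the four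
integrals become integrals seen from $z$ along two chains, $c\cup(c-\mathbf e_1)$ and the same chain
lowered by $\mathbf e_2$. The lower chain passes below $z$ and has the angle variation of the two
lower walls. The upper chain, if it passes below $z$, has that of the detour down $L-\mathbf
e_1-\mathbf e_2$, along the two lower walls and up $R-\mathbf e_2$. This explains the signs and the
factors 2. If $z$ lies below the upper chain, the angle is smaller by $2\pi$, which costs one $f$.
This happens exactly for the sources shifted by $\mathbf e_2$, those on $\Gamma_1\cup\Gamma_2$
(`kernelIntegral_four_images`, `kernelIntegral_piece`).

The topological point is that "above" only means joinable to a high point off the periodic curve.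
`logIntegral_two_periods` handles this: the angle variation along a long chain of periods, less the
value it would have if the chain avoided the vertical ray, is locally constant in the viewpoint and
vanishes at the high point. Remote periods are then discarded. -/

/-! ### Rectifiable curves and the fundamental theorem of calculus along them -/

/-- A continuous curve on `[0, 1]`, differentiable off a countable set, with integrable
derivative. -/
structure IsCurve {E : Type*} [NormedAddCommGroup E] [NormedSpace ℝ E] (c : ℝ → E) : Prop where
  continuousOn : ContinuousOn c (Icc 0 1)
  differentiable : ∃ P : Set ℝ, P.Countable ∧ ∀ t ∈ Ioo (0 : ℝ) 1 \ P, DifferentiableAt ℝ c t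
  integrable : IntervalIntegrable (deriv c) volume 0 1

section

variable {E G : Type*} [NormedAddCommGroup E] [NormedSpace ℝ E] [NormedAddCommGroup G]
  [NormedSpace ℝ G]

theorem IsCurve.intervalIntegrable_clm {c : ℝ → E} (hc : IsCurve c) {A : ℝ → E →L[ℝ] G}
    (hA : ContinuousOn A (Icc 0 1)) :
    IntervalIntegrable (fun t => A t (deriv c t)) volume 0 1 := by
  rw [intervalIntegrable_iff_integrableOn_Icc_of_le zero_le_one]
  obtain ⟨C, hC⟩ := isCompact_Icc.exists_bound_of_continuousOn hA
  refine (ContinuousLinearMap.id ℝ (E →L[ℝ] G)).integrable_of_bilin_of_bdd_left C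
    (hA.aestronglyMeasurable measurableSet_Icc) ?_
    ((intervalIntegrable_iff_integrableOn_Icc_of_le zero_le_one).1 hc.integrable)
  exact (ae_restrict_mem measurableSet_Icc).mono fun t ht => hC t ht

theorem IsCurve.integral_clm [CompleteSpace G] {c : ℝ → E} (hc : IsCurve c) {F : E → G}
    {F' : E → E →L[ℝ] G} (hF : ∀ t ∈ Icc (0 : ℝ) 1, HasFDerivAt F (F' (c t)) (c t))
    (hF' : ContinuousOn (fun t => F' (c t)) (Icc 0 1)) :
    ∫ t in (0 : ℝ)..1, F' (c t) (deriv c t) = F (c 1) - F (c 0) := by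
  obtain ⟨P, hP, hd⟩ := hc.differentiable
  refine integral_eq_of_hasDerivAt_off_countable_of_le (fun t => F (c t)) _ zero_le_one hP
    (fun t ht => (hF t ht).continuousAt.comp_continuousWithinAt (hc.continuousOn t ht))
    (fun t ht => ?_) (hc.intervalIntegrable_clm hF')
  exact (hF t (Ioo_subset_Icc_self ht.1)).comp_hasDerivAt t (hd t ht).hasDerivAt

theorem deriv_equiv_comp (A : E ≃L[ℝ] G) (c : ℝ → E) (t : ℝ) :
    deriv (fun t => A (c t)) t = A (deriv c t) := by
  by_cases ht : DifferentiableAt ℝ c t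
  · exact (A.hasFDerivAt.comp_hasDerivAt t ht.hasDerivAt).deriv
  · rw [deriv_zero_of_not_differentiableAt ht, map_zero]
    exact deriv_zero_of_not_differentiableAt fun h => ht (A.comp_differentiableAt_iff.1 h)

theorem IsCurve.equiv_comp {c : ℝ → E} (hc : IsCurve c) (A : E ≃L[ℝ] G) :
    IsCurve fun t => A (c t) where
  continuousOn := A.continuous.comp_continuousOn hc.continuousOn
  differentiable := by
    obtain ⟨P, hP, hd⟩ := hc.differentiable
    exact ⟨P, hP, fun t ht => A.differentiableAt.comp t (hd t ht)⟩
  integrable := by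
    rw [funext (deriv_equiv_comp A c)]
    exact ⟨A.toContinuousLinearMap.integrable_comp hc.integrable.1,
      A.toContinuousLinearMap.integrable_comp hc.integrable.2⟩

theorem IsCurve.add_const {c : ℝ → E} (hc : IsCurve c) (a : E) :
    IsCurve fun t => c t + a where
  continuousOn := hc.continuousOn.add continuousOn_const
  differentiable := by
    obtain ⟨P, hP, hd⟩ := hc.differentiable
    exact ⟨P, hP, fun t ht => (hd t ht).add_const a⟩
  integrable := by
    have h : deriv (fun t => c t + a) = deriv c := by
      ext t
      exact deriv_add_const a
    rw [h]
    exact hc.integrable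

theorem isCurve_seg (a d : E) : IsCurve fun t : ℝ => a + t • d where
  continuousOn := by fun_prop
  differentiable := ⟨∅, countable_empty, fun t _ => by fun_prop⟩
  integrable := by
    have h : deriv (fun t : ℝ => a + t • d) = fun _ => d := by
      ext t
      simpa using (((hasDerivAt_id t).smul_const d).const_add a).deriv
    rw [h]
    exact intervalIntegrable_const

end

theorem IsCurve.integral_complex {c : ℝ → ℂ} (hc : IsCurve c) {F F' : ℂ → ℂ}
    (hF : ∀ t ∈ Icc (0 : ℝ) 1, HasDerivAt F (F' (c t)) (c t))
    (hF' : ContinuousOn (fun t => F' (c t)) (Icc 0 1)) :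
    ∫ t in (0 : ℝ)..1, deriv c t * F' (c t) = F (c 1) - F (c 0) := by
  obtain ⟨P, hP, hd⟩ := hc.differentiable
  refine integral_eq_of_hasDerivAt_off_countable_of_le (fun t => F (c t)) _ zero_le_one hP
    (fun t ht => (hF t ht).continuousAt.comp_continuousWithinAt (hc.continuousOn t ht))
    (fun t ht => ?_) ?_
  · rw [mul_comm]
    exact (hF t (Ioo_subset_Icc_self ht.1)).comp t (hd t ht).hasDerivAt
  · exact hc.integrable.mul_continuousOn (by rwa [uIcc_of_le zero_le_one])

/-! ### The logarithmic integral along a curve -/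

/-- `∫_c dx / (x - z)`; its imaginary part is the variation along `c` of the angle seen
from `z`. -/
def logIntegral (c : ℝ → ℂ) (z : ℂ) : ℂ := ∫ t in (0 : ℝ)..1, deriv c t * (c t - z)⁻¹

/-- The branch of `log (x - z)`, up to a constant, that is cut along the ray from `z` in the
direction `d`. -/
def rayLog (d z x : ℂ) : ℂ := Complex.log (-(x - z) / d)

theorem rayLog_add_right (d z x w : ℂ) : rayLog d (z + w) x = rayLog d z (x - w) := by
  unfold rayLog
  congr 2
  ring

theorem logIntegral_add_const (c : ℝ → ℂ) (z w : ℂ) :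
    logIntegral (fun t => c t + w) z = logIntegral c (z - w) := by
  unfold logIntegral
  refine intervalIntegral.integral_congr fun t _ => ?_
  simp only [deriv_add_const]
  congr 2
  ring

/-- The quotient leaves the slit plane only if $u$ is a nonnegative multiple of $d$, that is, lies
on the cut. With $A$ the coordinate across $d$ and $B$ the one along $d$, this would force $A u=0$
and $B u\ge0$. -/
theorem neg_div_mem_slitPlane {d u : ℂ} (hd : d ≠ 0) {A B : ℂ →ₗ[ℝ] ℝ} (hA : A d = 0)
    (hB : B d = 1) (h : A u ≠ 0 ∨ B u < 0) : -u / d ∈ Complex.slitPlane := by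
  by_contra hs
  rw [Complex.mem_slitPlane_iff_not_le_zero, not_not, Complex.le_def] at hs
  have hu : u = (-(-u / d).re) • d := by
    have : (-u / d) = (((-u / d).re : ℝ) : ℂ) := by
      apply Complex.ext <;> simp [hs.2]
    rw [Complex.real_smul, Complex.ofReal_neg, ← this]
    field_simp
  have h1 : A u = 0 := by rw [hu, map_smul, hA, smul_zero]
  have h2 : 0 ≤ B u := by
    rw [hu, map_smul, hB, smul_eq_mul, mul_one]
    linarith [hs.1, Complex.zero_re]
  rcases h with h | h
  · exact h h1
  · linarith

theorem sub_ne_zero_of_slit {d z x : ℂ} (h : -(x - z) / d ∈ Complex.slitPlane) : x - z ≠ 0 := by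
  rintro h0
  simp [h0] at h

theorem logIntegral_eq_rayLog {c : ℝ → ℂ} (hc : IsCurve c) {d z : ℂ} (hd : d ≠ 0)
    (h : ∀ t ∈ Icc (0 : ℝ) 1, -(c t - z) / d ∈ Complex.slitPlane) :
    logIntegral c z = rayLog d z (c 1) - rayLog d z (c 0) := by
  refine hc.integral_complex (F := rayLog d z) (F' := fun x => (x - z)⁻¹) (fun t ht => ?_) ?_
  · have h0 := sub_ne_zero_of_slit (h t ht)
    have := ((((hasDerivAt_id (c t)).sub_const z).neg).div_const d).clog (h t ht)
    refine this.congr_deriv ?_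
    simp only [id, Pi.neg_apply]
    field_simp
  · exact (hc.continuousOn.sub continuousOn_const).inv₀
      fun t ht => sub_ne_zero_of_slit (h t ht)

/-- The principal logarithm of $(x-w)/(x-z)$ is a primitive of the difference of the integrands
along the whole curve, so no multiple of $2\pi i$ can appear. -/
theorem logIntegral_sub_logIntegral {c : ℝ → ℂ} (hc : IsCurve c) {z w : ℂ}
    (hz : ∀ t ∈ Icc (0 : ℝ) 1, c t - z ≠ 0) (hw : ∀ t ∈ Icc (0 : ℝ) 1, c t - w ≠ 0)
    (h : ∀ t ∈ Icc (0 : ℝ) 1, (c t - w) / (c t - z) ∈ Complex.slitPlane) :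
    logIntegral c w - logIntegral c z =
      Complex.log ((c 1 - w) / (c 1 - z)) - Complex.log ((c 0 - w) / (c 0 - z)) := by
  have hcz : ContinuousOn (fun t => (c t - z)⁻¹) (Icc 0 1) :=
    (hc.continuousOn.sub continuousOn_const).inv₀ hz
  have hcw : ContinuousOn (fun t => (c t - w)⁻¹) (Icc 0 1) :=
    (hc.continuousOn.sub continuousOn_const).inv₀ hw
  have key := hc.integral_complex (F := fun x => Complex.log ((x - w) / (x - z)))
    (F' := fun x => (x - w)⁻¹ - (x - z)⁻¹) (fun t ht => ?_) (hcw.sub hcz)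
  · rw [← key, logIntegral, logIntegral, ← intervalIntegral.integral_sub]
    · simp only [mul_sub]
    · exact hc.integrable.mul_continuousOn (by rwa [uIcc_of_le zero_le_one])
    · exact hc.integrable.mul_continuousOn (by rwa [uIcc_of_le zero_le_one])
  · have := ((((hasDerivAt_id (c t)).sub_const w).div
      ((hasDerivAt_id (c t)).sub_const z) (hz t ht))).clog (h t ht)
    refine this.congr_deriv ?_
    have h1 := hz t ht
    have h2 := hw t ht
    simp only [id, Pi.div_apply]
    field_simp

/-- If $w$ is closer to $z$ than the curve is, then $(x-w)/(x-z)=1+(z-w)/(x-z)$ stays in the unit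
disc around 1, hence off the cut. The increment of the logarithmic integral is therefore an end
point term, which telescopes along a chain of curves. -/
theorem eventually_logIntegral_sub {c : ℝ → ℂ} (hc : IsCurve c) {z : ℂ}
    (hz : ∀ t ∈ Icc (0 : ℝ) 1, c t ≠ z) :
    ∀ᶠ w in 𝓝 z, logIntegral c w - logIntegral c z =
      Complex.log ((c 1 - w) / (c 1 - z)) - Complex.log ((c 0 - w) / (c 0 - z)) := by
  have hK : IsCompact (c '' Icc 0 1) := isCompact_Icc.image_of_continuousOn hc.continuousOn
  have hzK : z ∈ (c '' Icc 0 1)ᶜ := by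
    rintro ⟨t, ht, h⟩
    exact hz t ht h
  obtain ⟨ε, hε, hball⟩ := Metric.isOpen_iff.1 hK.isClosed.isOpen_compl z hzK
  filter_upwards [Metric.ball_mem_nhds z hε] with w hw
  have hd : ∀ t ∈ Icc (0 : ℝ) 1, ε ≤ ‖c t - z‖ := by
    intro t ht
    by_contra hlt
    exact hball (by rwa [Metric.mem_ball, dist_eq_norm, ← not_le]) ⟨t, ht, rfl⟩
  rw [Metric.mem_ball, dist_eq_norm] at hw
  have hz' : ∀ t ∈ Icc (0 : ℝ) 1, c t - z ≠ 0 := fun t ht => sub_ne_zero.2 (hz t ht)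
  refine logIntegral_sub_logIntegral hc hz' (fun t ht h0 => ?_) fun t ht => ?_
  · have := hd t ht
    rw [sub_eq_zero.1 h0] at this
    linarith
  · have h1 : (c t - w) / (c t - z) = 1 + (z - w) / (c t - z) := by
      have := hz' t ht
      field_simp
      ring
    rw [h1]
    refine Complex.mem_slitPlane_of_norm_lt_one ?_
    rw [norm_div, div_lt_one (by linarith [hd t ht]), norm_sub_rev]
    linarith [hd t ht]

/-- The logarithm of a product is the sum of logarithms once the arguments add up within
$(-\pi,\pi]$. At $w=z$ the sum is the argument of a point of the slit plane, strictly inside this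
interval, and it varies continuously with $w$. -/
theorem eventually_rayLog_sub {d z x : ℂ} (hd : d ≠ 0)
    (h : -(x - z) / d ∈ Complex.slitPlane) :
    ∀ᶠ w in 𝓝 z, Complex.log ((x - w) / (x - z)) = rayLog d w x - rayLog d z x := by
  have h0 := sub_ne_zero_of_slit h
  have hq : ContinuousAt (fun w => (x - w) / (x - z)) z := by fun_prop
  have h1 : Tendsto (fun w => ((x - w) / (x - z)).arg + (-(x - z) / d).arg) (𝓝 z)
      (𝓝 (-(x - z) / d).arg) := by
    have h1 : (x - z) / (x - z) ∈ Complex.slitPlane := by simp [div_self h0]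
    have := ((Complex.continuousAt_arg h1).comp_of_eq hq rfl).tendsto.add_const
      ((-(x - z) / d).arg)
    simpa [Function.comp_def, div_self h0] using this
  have hm : (-(x - z) / d).arg ∈ Ioo (-Real.pi) Real.pi :=
    ⟨Complex.neg_pi_lt_arg _, lt_of_le_of_ne (Complex.arg_le_pi _) (Complex.slitPlane_arg_ne_pi h)⟩
  filter_upwards [h1 (Ioo_mem_nhds hm.1 hm.2), hq.eventually_ne (y := 0) (by simp [div_self h0])]
    with w hw hw0
  have := (Complex.log_mul_eq_add_log_iff (x := (x - w) / (x - z)) (y := -(x - z) / d)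
    hw0 (div_ne_zero (neg_ne_zero.2 h0) hd)).2
    (Ioo_subset_Ioc_self hw)
  rw [rayLog, rayLog, eq_sub_iff_add_eq, ← this]
  congr 1
  field_simp

/-! ### Angle variation along a periodic curve, seen from a point on one side of it -/

/-- The logarithmic integral, seen from `z`, along the `2 N` consecutive translates of `c` by
the multiples `-N, …, N - 1` of `e`. -/
def chainLog (c : ℝ → ℂ) (e : ℂ) (N : ℕ) (z : ℂ) : ℂ :=
  ∑ i ∈ Finset.range N, (logIntegral (fun t => c t + ((i : ℤ) : ℝ) • e) z +
    logIntegral (fun t => c t + ((-(i : ℤ) - 1 : ℤ) : ℝ) • e) z)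

/-- The translates are added in pairs $i$, $-i-1$, one at each end of the chain, so that every
partial sum is a chain centred at `c 0` and the sum telescopes. -/
theorem chainLog_eq {c : ℝ → ℂ} {e z : ℂ} {N : ℕ} {f : ℂ → ℂ} (hc : c 1 = c 0 + e)
    (h : ∀ m : ℤ, -N ≤ m → m < N → logIntegral (fun t => c t + (m : ℝ) • e) z =
      f (c 1 + (m : ℝ) • e) - f (c 0 + (m : ℝ) • e)) :
    chainLog c e N z = f (c 0 + (N : ℝ) • e) - f (c 0 - (N : ℝ) • e) := by
  have key : chainLog c e N z = ∑ i ∈ Finset.range N,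
      ((f (c 0 + ((i + 1 : ℕ) : ℝ) • e) - f (c 0 - ((i + 1 : ℕ) : ℝ) • e)) -
        (f (c 0 + (i : ℝ) • e) - f (c 0 - (i : ℝ) • e))) := by
    refine Finset.sum_congr rfl fun i hi => ?_
    rw [Finset.mem_range] at hi
    rw [h i (by omega) (by omega), h (-i - 1) (by omega) (by omega), hc]
    push_cast
    have e1 : c 0 + e + (i : ℝ) • e = c 0 + ((i : ℝ) + 1) • e := by module
    have e2 : c 0 + e + (-(i : ℝ) - 1) • e = c 0 - (i : ℝ) • e := by module
    have e3 : c 0 + (-(i : ℝ) - 1) • e = c 0 - ((i : ℝ) + 1) • e := by module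
    rw [e1, e2, e3]
    ring
  rw [key, Finset.sum_range_sub (fun i : ℕ => f (c 0 + (i : ℝ) • e) - f (c 0 - (i : ℝ) • e))]
  simp

section

variable {c : ℝ → ℂ} {e d : ℂ} {A B : ℂ →ₗ[ℝ] ℝ}

/-- The defect of `chainLog` with respect to a curve that does not cross the ray from `z` in the
direction `d`. -/
def chainDefect (c : ℝ → ℂ) (e d : ℂ) (N : ℕ) (z : ℂ) : ℂ :=
  chainLog c e N z - (rayLog d z (c 0 + (N : ℝ) • e) - rayLog d z (c 0 - (N : ℝ) • e))

/-- Both terms of the defect change by the same logarithms at the two extreme end points of the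
chain; the contributions of the interior junctions cancel. -/
theorem eventually_chainDefect_eq (hc : IsCurve c) (hce : c 1 = c 0 + e) (hd : d ≠ 0)
    (hAe : A e = 1) (hAd : A d = 0) (hBd : B d = 1) (hcA : |A (c 0)| ≤ 1) {z : ℂ} {N : ℕ}
    (hz : ∀ m : ℤ, ∀ t ∈ Icc (0 : ℝ) 1, c t + (m : ℝ) • e ≠ z) (hN : |A z| + 1 < N) :
    ∀ᶠ w in 𝓝 z, chainDefect c e d N w = chainDefect c e d N z := by
  have h1 : ∀ᶠ w in 𝓝 z, ∀ m ∈ Finset.Ico (-N : ℤ) N,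
      logIntegral (fun t => c t + (m : ℝ) • e) w - logIntegral (fun t => c t + (m : ℝ) • e) z =
      Complex.log ((c 1 + (m : ℝ) • e - w) / (c 1 + (m : ℝ) • e - z)) -
      Complex.log ((c 0 + (m : ℝ) • e - w) / (c 0 + (m : ℝ) • e - z)) := by
    rw [Filter.eventually_all_finset]
    exact fun m _ => eventually_logIntegral_sub (hc.add_const _) (hz m)
  obtain ⟨ha1, ha2⟩ := abs_le.1 hcA
  have hz1 := le_abs_self (A z)
  have hz2 := neg_abs_le (A z)
  -- The extreme end points have $A$-coordinates at least $N-1$ and at most $1-N$, hence are off the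
  -- line through $z$ in the direction $d$, by the choice of $N$.
  have h2 := eventually_rayLog_sub (z := z) (x := c 0 + (N : ℝ) • e) hd
    (neg_div_mem_slitPlane hd hAd hBd (Or.inl (by
      simp only [map_sub, map_add, map_smul, hAe, smul_eq_mul]
      intro h0
      linarith)))
  have h3 := eventually_rayLog_sub (z := z) (x := c 0 - (N : ℝ) • e) hd
    (neg_div_mem_slitPlane hd hAd hBd (Or.inl (by
      simp only [map_sub, map_smul, hAe, smul_eq_mul]
      intro h0
      linarith)))
  filter_upwards [h1, h2, h3] with w hw1 hw2 hw3
  have hsum : chainLog c e N w - chainLog c e N z =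
      Complex.log ((c 0 + (N : ℝ) • e - w) / (c 0 + (N : ℝ) • e - z)) -
      Complex.log ((c 0 - (N : ℝ) • e - w) / (c 0 - (N : ℝ) • e - z)) := by
    have key : chainLog c e N w - chainLog c e N z = ∑ i ∈ Finset.range N,
        ((Complex.log ((c 0 + ((i + 1 : ℕ) : ℝ) • e - w) / (c 0 + ((i + 1 : ℕ) : ℝ) • e - z)) -
          Complex.log ((c 0 - ((i + 1 : ℕ) : ℝ) • e - w) / (c 0 - ((i + 1 : ℕ) : ℝ) • e - z))) -
        (Complex.log ((c 0 + (i : ℝ) • e - w) / (c 0 + (i : ℝ) • e - z)) -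
          Complex.log ((c 0 - (i : ℝ) • e - w) / (c 0 - (i : ℝ) • e - z)))) := by
      rw [chainLog, chainLog, ← Finset.sum_sub_distrib]
      refine Finset.sum_congr rfl fun i hi => ?_
      rw [Finset.mem_range] at hi
      have g1 := hw1 i (by simp; omega)
      have g2 := hw1 (-i - 1) (by simp; omega)
      rw [hce] at g1 g2
      push_cast at g1 g2 ⊢
      have e1 : c 0 + e + (i : ℝ) • e = c 0 + ((i : ℝ) + 1) • e := by module
      have e2 : c 0 + e + (-(i : ℝ) - 1) • e = c 0 - (i : ℝ) • e := by module
      have e3 : c 0 + (-(i : ℝ) - 1) • e = c 0 - ((i : ℝ) + 1) • e := by module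
      rw [e1] at g1
      rw [e2, e3] at g2
      linear_combination g1 + g2
    rw [key, Finset.sum_range_sub (fun i : ℕ =>
      Complex.log ((c 0 + (i : ℝ) • e - w) / (c 0 + (i : ℝ) • e - z)) -
          Complex.log ((c 0 - (i : ℝ) • e - w) / (c 0 - (i : ℝ) • e - z)))]
    simp
  rw [hw2, hw3] at hsum
  unfold chainDefect
  linear_combination hsum

/-- From a viewpoint further in the direction $d$ than the whole chain, the outgoing ray meets no
translate, so each of them contributes an exact difference of `rayLog`. -/
theorem chainDefect_eq_zero (hc : IsCurve c) (hce : c 1 = c 0 + e) (hd : d ≠ 0)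
    (hAd : A d = 0) (hBd : B d = 1) {z : ℂ} (N : ℕ)
    (hz : ∀ m : ℤ, ∀ t ∈ Icc (0 : ℝ) 1, B (c t + (m : ℝ) • e) < B z) :
    chainDefect c e d N z = 0 := by
  rw [chainDefect, sub_eq_zero]
  refine chainLog_eq hce fun m _ _ => ?_
  refine logIntegral_eq_rayLog (hc.add_const _) hd fun t ht => ?_
  refine neg_div_mem_slitPlane hd hAd hBd (Or.inr ?_)
  rw [map_sub]
  linarith [hz m t ht]

/-- Far away translates of the curve do not contribute to the defect. -/
theorem chainDefect_succ (hc : IsCurve c) (hce : c 1 = c 0 + e) (hd : d ≠ 0)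
    (hAe : A e = 1) (hAd : A d = 0) (hBd : B d = 1)
    (hcA : ∀ t ∈ Icc (0 : ℝ) 1, A (c t) ∈ Ico (-1 : ℝ) 1) {z : ℂ} (hz : A z ∈ Ico (-1 : ℝ) 0)
    {N : ℕ} (hN : 1 ≤ N) :
    chainDefect c e d (N + 1) z = chainDefect c e d N z := by
  have hN' : (1 : ℝ) ≤ N := by exact_mod_cast hN
  have h1 : logIntegral (fun t => c t + ((N : ℤ) : ℝ) • e) z =
      rayLog d z (c 1 + ((N : ℤ) : ℝ) • e) - rayLog d z (c 0 + ((N : ℤ) : ℝ) • e) := by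
    refine logIntegral_eq_rayLog (hc.add_const _) hd fun t ht => ?_
    -- Translate $N\ge1$ has $A\ge0>A(z)$; below, translate $-N-1$ has $A<-1\le A(z)$. The half-open
    -- ranges make both inequalities strict.
    refine neg_div_mem_slitPlane hd hAd hBd (Or.inl (ne_of_gt ?_))
    simp only [map_sub, map_add, map_smul, hAe, smul_eq_mul, Int.cast_natCast]
    linarith [(hcA t ht).1, hz.2]
  have h2 : logIntegral (fun t => c t + ((-(N : ℤ) - 1 : ℤ) : ℝ) • e) z =
      rayLog d z (c 1 + ((-(N : ℤ) - 1 : ℤ) : ℝ) • e) -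
        rayLog d z (c 0 + ((-(N : ℤ) - 1 : ℤ) : ℝ) • e) := by
    refine logIntegral_eq_rayLog (hc.add_const _) hd fun t ht => ?_
    refine neg_div_mem_slitPlane hd hAd hBd (Or.inl (ne_of_lt ?_))
    simp only [map_sub, map_add, map_smul, hAe, smul_eq_mul]
    push_cast
    linarith [(hcA t ht).2, hz.1]
  rw [hce] at h1 h2
  rw [chainDefect, chainDefect, chainLog, Finset.sum_range_succ, h1, h2, ← chainLog]
  push_cast
  have e1 : c 0 + e + (N : ℝ) • e = c 0 + ((N : ℝ) + 1) • e := by module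
  have e2 : c 0 + e + (-(N : ℝ) - 1) • e = c 0 - (N : ℝ) • e := by module
  have e3 : c 0 + (-(N : ℝ) - 1) • e = c 0 - ((N : ℝ) + 1) • e := by module
  rw [e1, e2, e3]
  ring

theorem chainDefect_eq_one (hc : IsCurve c) (hce : c 1 = c 0 + e) (hd : d ≠ 0)
    (hAe : A e = 1) (hAd : A d = 0) (hBd : B d = 1)
    (hcA : ∀ t ∈ Icc (0 : ℝ) 1, A (c t) ∈ Ico (-1 : ℝ) 1) {z : ℂ} (hz : A z ∈ Ico (-1 : ℝ) 0)
    {N : ℕ} (hN : 1 ≤ N) :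
    chainDefect c e d N z = chainDefect c e d 1 z := by
  induction N, hN using Nat.le_induction with
  | base => rfl
  | succ n hn ih => rw [chainDefect_succ hc hce hd hAe hAd hBd hcA hz hn, ih]

/-- If `z` can be joined, off the periodic curve generated by `c`, to a point that lies further
than this curve in the direction `d`, then the logarithmic integral along two periods is that of
a curve that does not cross the ray from `z` in the direction `d`. -/
theorem logIntegral_two_periods (hc : IsCurve c) (hce : c 1 = c 0 + e) (hd : d ≠ 0)
    (hAe : A e = 1) (hAd : A d = 0) (hBd : B d = 1)
    (hcA : ∀ t ∈ Icc (0 : ℝ) 1, A (c t) ∈ Ico (-1 : ℝ) 1) {z w : ℂ} (hz : A z ∈ Ico (-1 : ℝ) 0)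
    (hzw : JoinedIn {x | ∀ m : ℤ, ∀ t ∈ Icc (0 : ℝ) 1, c t + (m : ℝ) • e ≠ x} z w)
    (hw : ∀ m : ℤ, ∀ t ∈ Icc (0 : ℝ) 1, B (c t + (m : ℝ) • e) < B w) :
    logIntegral c z + logIntegral c (z + e) =
      rayLog d z (c 0 + e) - rayLog d z (c 0 - e) := by
  obtain ⟨γ, hγ⟩ := hzw
  -- The path may leave the expanded cell. By compactness $|A|$ is bounded on it, and the chain is
  -- taken long enough for its ends to stay clear of the ray from every point of the path.
  have hAc : Continuous fun s => |A (γ s)| :=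
    (A.continuous_of_finiteDimensional.comp γ.continuous).abs
  obtain ⟨C, hC⟩ := isCompact_univ.exists_bound_of_continuousOn hAc.continuousOn
  obtain ⟨N, hN⟩ := exists_nat_gt (C + 1)
  have hAs : ∀ s, |A (γ s)| + 1 < N := fun s => by
    have := hC s (mem_univ s)
    rw [Real.norm_eq_abs, abs_abs] at this
    linarith
  have hN1 : 1 ≤ N := by
    have : (0 : ℝ) < N := lt_trans (by positivity) (hAs 0)
    exact_mod_cast this
  have h0 := hcA 0 ⟨le_rfl, zero_le_one⟩
  have hloc : IsLocallyConstant fun s => chainDefect c e d N (γ s) := by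
    rw [IsLocallyConstant.iff_eventually_eq]
    intro s
    exact γ.continuous.continuousAt.eventually
      (eventually_chainDefect_eq hc hce hd hAe hAd hBd (abs_le.2 ⟨h0.1, h0.2.le⟩)
        (hγ s) (hAs s))
  have hconst := hloc.apply_eq_of_preconnectedSpace 0 1
  simp only [γ.source, γ.target] at hconst
  -- The defect vanishes at the far point, hence at $z$, and there the chain can be shortened to the
  -- translates $0$ and $-1$.
  rw [chainDefect_eq_zero hc hce hd hAd hBd N hw,
    chainDefect_eq_one hc hce hd hAe hAd hBd hcA hz hN1, chainDefect, sub_eq_zero] at hconst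
  simp only [chainLog, Finset.range_one, Finset.sum_singleton] at hconst
  rw [logIntegral_add_const, logIntegral_add_const] at hconst
  simpa using hconst

end

/-! ### Skew coordinates -/

/-- `coordA` as a linear map. -/
def coordALin (e₁ e₂ : Plane) : Plane →ₗ[ℝ] ℝ where
  toFun := coordA e₁ e₂
  map_add' x y := by simp [coordA, cross]; ring
  map_smul' a x := by simp [coordA, cross]; ring

/-- `coordB` as a linear map. -/
def coordBLin (e₁ e₂ : Plane) : Plane →ₗ[ℝ] ℝ where
  toFun := coordB e₁ e₂
  map_add' x y := by simp [coordB, cross]; ring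
  map_smul' a x := by simp [coordB, cross]; ring

section

variable {e₁ e₂ : Plane}

theorem coordA_add (x y : Plane) : coordA e₁ e₂ (x + y) = coordA e₁ e₂ x + coordA e₁ e₂ y :=
  (coordALin e₁ e₂).map_add x y

theorem coordA_sub (x y : Plane) : coordA e₁ e₂ (x - y) = coordA e₁ e₂ x - coordA e₁ e₂ y :=
  (coordALin e₁ e₂).map_sub x y

theorem coordA_neg (x : Plane) : coordA e₁ e₂ (-x) = -coordA e₁ e₂ x :=
  (coordALin e₁ e₂).map_neg x

theorem coordA_smul (a : ℝ) (x : Plane) : coordA e₁ e₂ (a • x) = a * coordA e₁ e₂ x :=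
  (coordALin e₁ e₂).map_smul a x

theorem coordB_add (x y : Plane) : coordB e₁ e₂ (x + y) = coordB e₁ e₂ x + coordB e₁ e₂ y :=
  (coordBLin e₁ e₂).map_add x y

theorem coordB_sub (x y : Plane) : coordB e₁ e₂ (x - y) = coordB e₁ e₂ x - coordB e₁ e₂ y :=
  (coordBLin e₁ e₂).map_sub x y

theorem coordB_neg (x : Plane) : coordB e₁ e₂ (-x) = -coordB e₁ e₂ x :=
  (coordBLin e₁ e₂).map_neg x

theorem coordB_smul (a : ℝ) (x : Plane) : coordB e₁ e₂ (a • x) = a * coordB e₁ e₂ x :=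
  (coordBLin e₁ e₂).map_smul a x

theorem coordA_e₁ (he : 0 < cross e₁ e₂) : coordA e₁ e₂ e₁ = 1 := div_self he.ne'

theorem coordA_e₂ : coordA e₁ e₂ e₂ = 0 := by simp [coordA, cross, mul_comm]

theorem coordB_e₁ : coordB e₁ e₂ e₁ = 0 := by simp [coordB, cross, mul_comm]

theorem coordB_e₂ (he : 0 < cross e₁ e₂) : coordB e₁ e₂ e₂ = 1 := div_self he.ne'

theorem continuous_coordA : Continuous (coordA e₁ e₂) :=
  (coordALin e₁ e₂).continuous_of_finiteDimensional

theorem continuous_coordB : Continuous (coordB e₁ e₂) :=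
  (coordBLin e₁ e₂).continuous_of_finiteDimensional

end

/-! ### The plane as the complex line -/

/-- The isometry `x ↦ x₁ + i x₂`. -/
def toC : Plane ≃ₗᵢ[ℝ] ℂ := Complex.orthonormalBasisOneI.repr.symm

@[simp] theorem toC_re (x : Plane) : (toC x).re = x 0 := by
  simp [toC, ← OrthonormalBasis.sum_repr_symm]

@[simp] theorem toC_im (x : Plane) : (toC x).im = x 1 := by
  simp [toC, ← OrthonormalBasis.sum_repr_symm]

theorem toC_ne_zero {x : Plane} (hx : x ≠ 0) : toC x ≠ 0 := by simpa using hx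

theorem isCurve_toC {c : ℝ → Plane} (hc : IsCurve c) : IsCurve fun t => toC (c t) :=
  hc.equiv_comp toC.toContinuousLinearEquiv

theorem deriv_toC (c : ℝ → Plane) (t : ℝ) : deriv (fun t => toC (c t)) t = toC (deriv c t) :=
  deriv_equiv_comp toC.toContinuousLinearEquiv c t

theorem im_div_toC (x y : Plane) : (toC x / toC y).im = -cross x y / ‖y‖ ^ 2 := by
  rw [Complex.div_im, Complex.normSq_apply, EuclideanSpace.norm_sq_eq]
  simp [cross, Fin.sum_univ_two, ← sq]
  ring

/-- The single-valued part of the primitive of the traction kernel. -/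
def kernelPrimitive (r : ℂ) : ℂ := r / (4 * Real.pi * Complex.I * (starRingEnd ℂ) r)

/-! ### The traction kernel in complex form and its integral along a curve -/

/-- For $n=h^\perp$ one has $-(r\cdot n)/|r|^2=\mathrm{Im}(h/r)$, and $r\,(r\cdot
f)/|r|^2=\frac12(f+\frac r{\bar r}\bar f)$ because $r\cdot f=\frac12(\bar r f+r\bar f)$. -/
theorem toC_tractionKernel {x z : Plane} (hxz : x ≠ z) (h f : Plane) :
    toC (tractionKernel x (perp h) z f) =
      ((1 / (2 * Real.pi) * (toC h * (toC x - toC z)⁻¹).im : ℝ) : ℂ) *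
        (toC f + (toC x - toC z) / (starRingEnd ℂ) (toC x - toC z) * (starRingEnd ℂ) (toC f)) := by
  obtain ⟨r, rfl⟩ : ∃ r, x = z + r := ⟨x - z, by simp⟩
  have hr : r ≠ 0 := by simpa using hxz
  have h1 : toC (z + r) - toC z = toC r := by simp
  have h0 : toC r ≠ 0 := toC_ne_zero hr
  have hs : (r 0 * r 0 + r 1 * r 1) ≠ 0 := by
    have := (Complex.normSq_pos.2 h0).ne'
    rwa [Complex.normSq_apply, toC_re, toC_im] at this
  have hq : toC r / (starRingEnd ℂ) (toC r) =
      (((r 0 * r 0 + r 1 * r 1)⁻¹ : ℝ) : ℂ) * (toC r * toC r) := by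
    have hb : (starRingEnd ℂ) (toC r) ≠ 0 := by simpa using hr
    rw [div_eq_iff hb]
    have : toC r * (starRingEnd ℂ) (toC r) = ((r 0 * r 0 + r 1 * r 1 : ℝ) : ℂ) := by
      rw [Complex.mul_conj, Complex.normSq_apply, toC_re, toC_im]
    have hs' : ((r 0 * r 0 + r 1 * r 1 : ℝ) : ℂ) ≠ 0 := by exact_mod_cast hs
    rw [Complex.ofReal_inv, mul_assoc, mul_assoc, this, mul_comm (toC r), inv_mul_cancel_left₀ hs']
  have hpi := Real.pi_ne_zero
  rw [h1, hq, ← div_eq_mul_inv, im_div_toC, tractionKernel, add_sub_cancel_left,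
    EuclideanSpace.norm_sq_eq]
  simp only [PiLp.inner_apply, Fin.sum_univ_two, perp, cross, Real.norm_eq_abs, sq_abs]
  have hs2 : r 0 ^ 2 + r 1 ^ 2 ≠ 0 := by simpa [sq] using hs
  apply Complex.ext
  · simp only [map_smul, Complex.smul_re, Complex.add_re, Complex.mul_re, Complex.mul_im, Complex.conj_re,
      Complex.conj_im, toC_re,
      toC_im, Complex.ofReal_re, Complex.ofReal_im]
    simp
    field_simp
    ring
  · simp only [map_smul, Complex.smul_im, Complex.add_im, Complex.mul_re, Complex.mul_im, Complex.conj_re,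
      Complex.conj_im, toC_re,
      toC_im, Complex.ofReal_re, Complex.ofReal_im]
    simp
    field_simp
    ring

/-- `∫_c Gᵗ(·, z) f ds`. -/
def kernelIntegral (c : ℝ → Plane) (z f : Plane) : Plane :=
  ∫ t in (0 : ℝ)..1, tractionKernel (c t) (perp (deriv c t)) z f

/-- In polar form $r/\bar r=e^{2i\theta}$ and $\mathrm{Im}(dr/r)=d\theta$, so that
$\frac1{2\pi}e^{2i\theta}d\theta=d\big(e^{2i\theta}/4\pi i\big)$. -/
theorem hasDerivAt_kernelPrimitive {r : ℝ → ℂ} {r' : ℂ} {t : ℝ} (hr : HasDerivAt r r' t)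
    (h0 : r t ≠ 0) :
    HasDerivAt (fun t => kernelPrimitive (r t))
      (((1 / (2 * Real.pi) * (r' * (r t)⁻¹).im : ℝ) : ℂ) * (r t / (starRingEnd ℂ) (r t))) t := by
  have hconj : HasDerivAt (fun t => (starRingEnd ℂ) (r t)) ((starRingEnd ℂ) r') t :=
    Complex.conjCLE.toContinuousLinearMap.hasFDerivAt.comp_hasDerivAt t hr
  have hb : (starRingEnd ℂ) (r t) ≠ 0 := by simpa using h0
  have hpi : (Real.pi : ℂ) ≠ 0 := by exact_mod_cast Real.pi_ne_zero
  have hk : (4 * Real.pi * Complex.I : ℂ) ≠ 0 := by simp [hpi]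
  refine (hr.div (hconj.const_mul (4 * Real.pi * Complex.I : ℂ)) (mul_ne_zero hk hb)).congr_deriv ?_
  rw [Complex.ofReal_mul, Complex.im_eq_sub_conj]
  simp only [map_mul, map_inv₀]
  push_cast
  have hI := Complex.I_ne_zero
  field_simp
  ring

/-- Only the coefficient of $f$, the angle variation, depends on the path; the coefficient of $\bar
f$ is determined by the end points. -/
theorem toC_kernelIntegral {c : ℝ → Plane} (hc : IsCurve c) {z : Plane}
    (hz : ∀ t ∈ Icc (0 : ℝ) 1, c t ≠ z) (f : Plane) :
    toC (kernelIntegral c z f) =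
      ((1 / (2 * Real.pi) * (logIntegral (fun t => toC (c t)) (toC z)).im : ℝ) : ℂ) * toC f +
      (kernelPrimitive (toC (c 1) - toC z) - kernelPrimitive (toC (c 0) - toC z)) *
        (starRingEnd ℂ) (toC f) := by
  have hC := isCurve_toC hc
  have hne : ∀ t ∈ Icc (0 : ℝ) 1, toC (c t) - toC z ≠ 0 := fun t ht => by
    rw [← map_sub]
    exact toC_ne_zero (sub_ne_zero.2 (hz t ht))
  have hcont : ContinuousOn (fun t => toC (c t) - toC z) (Icc 0 1) :=
    hC.continuousOn.sub continuousOn_const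
  have hintg : IntervalIntegrable
      (fun t => deriv (fun t => toC (c t)) t * (toC (c t) - toC z)⁻¹) volume 0 1 :=
    hC.integrable.mul_continuousOn (by
      rw [uIcc_of_le zero_le_one]
      exact hcont.inv₀ hne)
  have him : IntervalIntegrable
      (fun t => ((1 / (2 * Real.pi) *
        (deriv (fun t => toC (c t)) t * (toC (c t) - toC z)⁻¹).im : ℝ) : ℂ)) volume 0 1 := by
    have : IntervalIntegrable
      (fun t => (deriv (fun t => toC (c t)) t * (toC (c t) - toC z)⁻¹).im) volume 0 1 :=
      ⟨hintg.1.im, hintg.2.im⟩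
    exact ⟨(this.const_mul _).1.ofReal, (this.const_mul _).2.ofReal⟩
  have hq : ContinuousOn
      (fun t => (toC (c t) - toC z) / (starRingEnd ℂ) (toC (c t) - toC z)) (Icc 0 1) :=
    hcont.div (Complex.continuous_conj.comp_continuousOn hcont) fun t ht => by
      simpa only [ne_eq, map_eq_zero] using hne t ht
  have hintg2 := him.mul_continuousOn (g := fun t => (toC (c t) - toC z) /
    (starRingEnd ℂ) (toC (c t) - toC z)) (by rwa [uIcc_of_le zero_le_one])
  have h2 : ∫ t in (0 : ℝ)..1, ((1 / (2 * Real.pi) *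
        (deriv (fun t => toC (c t)) t * (toC (c t) - toC z)⁻¹).im : ℝ) : ℂ) *
        ((toC (c t) - toC z) / (starRingEnd ℂ) (toC (c t) - toC z)) =
      kernelPrimitive (toC (c 1) - toC z) - kernelPrimitive (toC (c 0) - toC z) := by
    obtain ⟨P, hP, hd⟩ := hC.differentiable
    refine integral_eq_of_hasDerivAt_off_countable_of_le
      (fun t => kernelPrimitive (toC (c t) - toC z)) _ zero_le_one hP ?_ (fun t ht => ?_) hintg2
    · unfold kernelPrimitive
      have hpi : (Real.pi : ℂ) ≠ 0 := by exact_mod_cast Real.pi_ne_zero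
      refine hcont.div (continuousOn_const.mul
        (Complex.continuous_conj.comp_continuousOn hcont)) fun t ht => ?_
      refine mul_ne_zero (by simp [hpi]) ?_
      simpa only [ne_eq, map_eq_zero] using hne t ht
    · exact hasDerivAt_kernelPrimitive ((hd t ht).hasDerivAt.sub_const _)
        (hne t (Ioo_subset_Icc_self ht.1))
  have h1 : ∫ t in (0 : ℝ)..1, ((1 / (2 * Real.pi) *
        (deriv (fun t => toC (c t)) t * (toC (c t) - toC z)⁻¹).im : ℝ) : ℂ) =
      ((1 / (2 * Real.pi) * (logIntegral (fun t => toC (c t)) (toC z)).im : ℝ) : ℂ) := by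
    rw [intervalIntegral.integral_ofReal, intervalIntegral.integral_const_mul]
    congr 2
    exact Complex.imCLM.intervalIntegral_comp_comm hintg
  rw [← h1, ← h2, ← intervalIntegral.integral_mul_const, ← intervalIntegral.integral_mul_const,
    ← intervalIntegral.integral_add (him.mul_const _) (hintg2.mul_const _), kernelIntegral]
  have hcomm : toC (∫ t in (0 : ℝ)..1, tractionKernel (c t) (perp (deriv c t)) z f) =
      ∫ t in (0 : ℝ)..1, toC (tractionKernel (c t) (perp (deriv c t)) z f) := by
    rw [intervalIntegral.integral_of_le zero_le_one, intervalIntegral.integral_of_le zero_le_one]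
    exact (toC.toContinuousLinearEquiv.integral_comp_comm _).symm
  rw [hcomm]
  refine intervalIntegral.integral_congr fun t ht => ?_
  rw [uIcc_of_le zero_le_one] at ht
  rw [toC_tractionKernel (hz t ht), deriv_toC]
  ring

/-! ### The traction integral of a single source -/

section

variable {e₁ e₂ : Plane}

/-- `coordA` on the complex line. -/
def complexCoordA (e₁ e₂ : Plane) : ℂ →ₗ[ℝ] ℝ :=
  coordALin e₁ e₂ ∘ₗ toC.symm.toLinearEquiv.toLinearMap

/-- `coordB` on the complex line. -/
def complexCoordB (e₁ e₂ : Plane) : ℂ →ₗ[ℝ] ℝ :=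
  coordBLin e₁ e₂ ∘ₗ toC.symm.toLinearEquiv.toLinearMap

@[simp] theorem complexCoordA_toC (x : Plane) :
    complexCoordA e₁ e₂ (toC x) = coordA e₁ e₂ x :=
  congrArg (coordA e₁ e₂) (toC.symm_apply_apply x)

@[simp] theorem complexCoordB_toC (x : Plane) :
    complexCoordB e₁ e₂ (toC x) = coordB e₁ e₂ x :=
  congrArg (coordB e₁ e₂) (toC.symm_apply_apply x)

theorem e₂_ne_zero (he : 0 < cross e₁ e₂) : e₂ ≠ 0 := by
  rintro rfl
  simp [cross] at he

theorem toC_slit (he : 0 < cross e₁ e₂) {x z : Plane}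
    (h : coordA e₁ e₂ (x - z) ≠ 0 ∨ coordB e₁ e₂ (x - z) < 0) :
    -(toC x - toC z) / toC e₂ ∈ Complex.slitPlane := by
  refine neg_div_mem_slitPlane (toC_ne_zero (e₂_ne_zero he))
    (A := complexCoordA e₁ e₂)
    (B := complexCoordB e₁ e₂) ?_ ?_ ?_
  · simpa using (coordA_e₂ : coordA e₁ e₂ e₂ = 0)
  · simpa using coordB_e₂ he
  · rw [← map_sub]
    simpa only [complexCoordA_toC, complexCoordB_toC] using h

theorem logIntegral_toC (he : 0 < cross e₁ e₂) {c : ℝ → Plane} (hc : IsCurve c) {z : Plane}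
    (h : ∀ t ∈ Icc (0 : ℝ) 1, coordA e₁ e₂ (c t - z) ≠ 0 ∨ coordB e₁ e₂ (c t - z) < 0) :
    logIntegral (fun t => toC (c t)) (toC z) =
      rayLog (toC e₂) (toC z) (toC (c 1)) - rayLog (toC e₂) (toC z) (toC (c 0)) :=
  logIntegral_eq_rayLog (isCurve_toC hc) (toC_ne_zero (e₂_ne_zero he))
    fun t ht => toC_slit he (h t ht)

theorem joinedIn_toC {c : ℝ → Plane} {z w : Plane} (h : JoinedIn (periodicCurve e₁ c)ᶜ z w) :
    JoinedIn {x | ∀ m : ℤ, ∀ t ∈ Icc (0 : ℝ) 1, toC (c t) + (m : ℝ) • toC e₁ ≠ x}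
      (toC z) (toC w) := by
  obtain ⟨γ, hγ⟩ := h
  refine ⟨γ.map toC.continuous, fun s m t ht heq => hγ s ⟨m, t, ht, ?_⟩⟩
  apply toC.injective
  simpa using heq.symm

theorem logIntegral_toC_above (he : 0 < cross e₁ e₂) {c : ℝ → Plane} (hc : IsCurve c)
    (hce : c 1 = c 0 + e₁) (hcA : ∀ t ∈ Icc (0 : ℝ) 1, coordA e₁ e₂ (c t) ∈ Ico (-1 : ℝ) 1)
    {z : Plane} (hz : coordA e₁ e₂ z ∈ Ico (-1 : ℝ) 0) (h : LiesAbove e₁ e₂ c z) :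
    logIntegral (fun t => toC (c t)) (toC z) + logIntegral (fun t => toC (c t)) (toC (z + e₁)) =
      rayLog (toC e₂) (toC z) (toC (c 0 + e₁)) - rayLog (toC e₂) (toC z) (toC (c 0 - e₁)) := by
  obtain ⟨w, hzw, hw⟩ := h
  rw [map_add, map_add, map_sub]
  refine logIntegral_two_periods (w := toC w) (isCurve_toC hc) (by simp [hce])
    (toC_ne_zero (e₂_ne_zero he))
    (A := complexCoordA e₁ e₂)
    (B := complexCoordB e₁ e₂) ?_ ?_ ?_ ?_ ?_
    (joinedIn_toC hzw) fun m t ht => ?_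
  · simpa using coordA_e₁ he
  · simpa using (coordA_e₂ : coordA e₁ e₂ e₂ = 0)
  · simpa using coordB_e₂ he
  · exact fun t ht => by simpa using hcA t ht
  · simpa using hz
  · rw [← map_smul, ← map_add, complexCoordB_toC, complexCoordB_toC]
    exact hw _ ⟨m, t, ht, rfl⟩

/-- This is the situation of `logIntegral_toC_above` turned upside down: the ray is $-\mathbf e_2$
and the height is $-b$, while the coordinate $a$ is kept. -/
theorem logIntegral_toC_below (he : 0 < cross e₁ e₂) {c : ℝ → Plane} (hc : IsCurve c)
    (hce : c 1 = c 0 + e₁) (hcA : ∀ t ∈ Icc (0 : ℝ) 1, coordA e₁ e₂ (c t) ∈ Ico (-1 : ℝ) 1)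
    {z : Plane} (hz : coordA e₁ e₂ z ∈ Ico (-1 : ℝ) 0) (h : LiesBelow e₁ e₂ c z) :
    logIntegral (fun t => toC (c t)) (toC z) + logIntegral (fun t => toC (c t)) (toC (z + e₁)) =
      rayLog (-toC e₂) (toC z) (toC (c 0 + e₁)) - rayLog (-toC e₂) (toC z) (toC (c 0 - e₁)) := by
  obtain ⟨w, hzw, hw⟩ := h
  rw [map_add, map_add, map_sub]
  refine logIntegral_two_periods (w := toC w) (isCurve_toC hc) (by simp [hce])
    (neg_ne_zero.2 (toC_ne_zero (e₂_ne_zero he)))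
    (A := complexCoordA e₁ e₂)
    (B := -complexCoordB e₁ e₂) ?_ ?_ ?_ ?_ ?_
    (joinedIn_toC hzw) fun m t ht => ?_
  · simpa using coordA_e₁ he
  · simpa using (coordA_e₂ : coordA e₁ e₂ e₂ = 0)
  · simpa using coordB_e₂ he
  · exact fun t ht => by simpa using hcA t ht
  · simpa using hz
  · rw [← map_smul, ← map_add, LinearMap.neg_apply, LinearMap.neg_apply, complexCoordB_toC,
      complexCoordB_toC]
    exact neg_lt_neg (hw _ ⟨m, t, ht, rfl⟩)

theorem im_toC_div_e₂ (x : Plane) (he : 0 < cross e₁ e₂) :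
    (toC x / toC e₂).im = -(cross e₁ e₂ / ‖e₂‖ ^ 2) * coordA e₁ e₂ x := by
  rw [im_div_toC, coordA]
  field_simp

/-- With $u=(x-z)/\mathbf e_2$ the two branches are $\log u$ and $\log(-u)$. By the orientation of
the basis, $x$ to the right of $z$ means $\mathrm{Im}\,u<0$, where $\arg(-u)=\arg u+\pi$. On the
left the sign is reversed. -/
theorem rayLog_neg_im_right (he : 0 < cross e₁ e₂) {x z : Plane}
    (h : 0 < coordA e₁ e₂ (x - z)) :
    (rayLog (-toC e₂) (toC z) (toC x)).im =
      (rayLog (toC e₂) (toC z) (toC x)).im - Real.pi := by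
  have hpos : 0 < cross e₁ e₂ / ‖e₂‖ ^ 2 := by
    have := norm_pos_iff.2 (e₂_ne_zero he)
    positivity
  have him : (toC (x - z) / toC e₂).im < 0 := by
    rw [im_toC_div_e₂ _ he, neg_mul, neg_lt_zero]
    positivity
  rw [rayLog, rayLog, ← map_sub, neg_div_neg_eq, neg_div, Complex.log_im, Complex.log_im,
    Complex.arg_neg_eq_arg_add_pi_of_im_neg him]
  ring

theorem rayLog_neg_im_left (he : 0 < cross e₁ e₂) {x z : Plane}
    (h : coordA e₁ e₂ (x - z) < 0) :
    (rayLog (-toC e₂) (toC z) (toC x)).im =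
      (rayLog (toC e₂) (toC z) (toC x)).im + Real.pi := by
  have hpos : 0 < cross e₁ e₂ / ‖e₂‖ ^ 2 := by
    have := norm_pos_iff.2 (e₂_ne_zero he)
    positivity
  have him : 0 < (toC (x - z) / toC e₂).im := by
    rw [im_toC_div_e₂ _ he]
    exact mul_pos_of_neg_of_neg (neg_lt_zero.2 hpos) h
  rw [rayLog, rayLog, ← map_sub, neg_div_neg_eq, neg_div, Complex.log_im, Complex.log_im,
    Complex.arg_neg_eq_arg_sub_pi_of_im_pos him]
  ring

theorem isCurve_shiftCurve {c : ℝ → Plane} (hc : IsCurve c) (a : Plane) :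
    IsCurve (shiftCurve c a) := by
  have : shiftCurve c a = fun t => c t + -a := by
    ext1 t
    exact sub_eq_add_neg _ _
  rw [this]
  exact hc.add_const _

theorem coordA_corner (he : 0 < cross e₁ e₂) : coordA e₁ e₂ (corner e₁ e₂) = -(1 / 2) := by
  rw [corner, coordA_neg, coordA_smul, coordA_add, coordA_e₁ he, coordA_e₂]
  ring

theorem coordB_corner (he : 0 < cross e₁ e₂) : coordB e₁ e₂ (corner e₁ e₂) = -(1 / 2) := by
  rw [corner, coordB_neg, coordB_smul, coordB_add, coordB_e₁, coordB_e₂ he]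
  ring

theorem LiesAbove.not_mem {c : ℝ → Plane} {z : Plane} (h : LiesAbove e₁ e₂ c z) :
    z ∉ periodicCurve e₁ c := by
  obtain ⟨w, hw, -⟩ := h
  exact hw.source_mem

theorem LiesBelow.not_mem {c : ℝ → Plane} {z : Plane} (h : LiesBelow e₁ e₂ c z) :
    z ∉ periodicCurve e₁ c := by
  obtain ⟨w, hw, -⟩ := h
  exact hw.source_mem

theorem ne_of_not_mem_periodicCurve {c : ℝ → Plane} {z : Plane} (h : z ∉ periodicCurve e₁ c)
    (m : ℤ) {t : ℝ} (ht : t ∈ Icc (0 : ℝ) 1) : c t ≠ z + (m : ℝ) • e₁ := by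
  rintro heq
  exact h ⟨-m, t, ht, by rw [heq]; push_cast; module⟩

/-- Seen from $z$, the source $z+\mathbf e_1$ acts on the curve $c-\mathbf e_1$, which ends where
$c$ begins. The primitive at this junction cancels. -/
theorem toC_kernelIntegral_two_periods {c : ℝ → Plane} (hc : IsCurve c) (hce : c 1 = c 0 + e₁)
    {z : Plane} (hz : z ∉ periodicCurve e₁ c) (f : Plane) :
    toC (kernelIntegral c z f + kernelIntegral c (z + e₁) f) =
      ((1 / (2 * Real.pi) * (logIntegral (fun t => toC (c t)) (toC z) +
        logIntegral (fun t => toC (c t)) (toC (z + e₁))).im : ℝ) : ℂ) * toC f +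
      (kernelPrimitive (toC (c 0 + e₁ - z)) - kernelPrimitive (toC (c 0 - e₁ - z))) *
        (starRingEnd ℂ) (toC f) := by
  rw [map_add, toC_kernelIntegral hc (fun t ht => by
      simpa using ne_of_not_mem_periodicCurve hz 0 ht),
    toC_kernelIntegral hc (fun t ht => by simpa using ne_of_not_mem_periodicCurve hz 1 ht)]
  simp only [← map_sub, hce, Complex.add_im]
  have h1 : c 0 + e₁ - (z + e₁) = c 0 - z := by abel
  have h2 : c 0 - (z + e₁) = c 0 - e₁ - z := by abel
  rw [h1, h2]
  push_cast
  ring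

theorem toC_kernelIntegral_above (he : 0 < cross e₁ e₂) {c : ℝ → Plane} (hc : IsCurve c)
    {z : Plane}
    (h : ∀ t ∈ Icc (0 : ℝ) 1, coordA e₁ e₂ (c t - z) ≠ 0 ∨ coordB e₁ e₂ (c t - z) < 0)
    (f : Plane) :
    toC (kernelIntegral c z f) =
      ((1 / (2 * Real.pi) * ((rayLog (toC e₂) (toC z) (toC (c 1))).im -
        (rayLog (toC e₂) (toC z) (toC (c 0))).im) : ℝ) : ℂ) * toC f +
      (kernelPrimitive (toC (c 1 - z)) - kernelPrimitive (toC (c 0 - z))) *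
        (starRingEnd ℂ) (toC f) := by
  rw [toC_kernelIntegral hc, logIntegral_toC he hc h, Complex.sub_im, map_sub, map_sub]
  rintro t ht rfl
  simpa [coordA, coordB, cross] using h t ht

/-- The contribution of one source, in terms of its image `z` in the lower left quadrant of the
expanded cell. The number `s` tells whether `z` lies above `c` or below. -/
theorem kernelIntegral_four_images (he : 0 < cross e₁ e₂) {c : ℝ → Plane} (hc : IsCurve c)
    (hc0 : c 0 = corner e₁ e₂) (hc1 : c 1 = corner e₁ e₂ + e₁)
    (hcA : ∀ t ∈ Icc (0 : ℝ) 1, coordA e₁ e₂ (c t) ∈ Ico (-1 : ℝ) 1)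
    {z : Plane} (hzA : coordA e₁ e₂ z ∈ Ico (-1 : ℝ) 0) (hzB : coordB e₁ e₂ z ∈ Ico (-1 : ℝ) 0)
    {s : ℝ} (hz2 : LiesAbove e₁ e₂ c (z + e₂))
    (hz : LiesAbove e₁ e₂ c z ∧ s = 0 ∨ LiesBelow e₁ e₂ c z ∧ s = 1) (f : Plane) :
    (kernelIntegral c z f + kernelIntegral c (z + e₁) f) +
      (kernelIntegral c (z + e₂) f + kernelIntegral c (z + e₂ + e₁) f) =
    kernelIntegral (shiftCurve (wallR e₁ e₂) e₂) z f
      - kernelIntegral (shiftCurve (wallL e₁ e₂) (e₁ + e₂)) z f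
      + (2 : ℝ) • kernelIntegral (shiftCurve (wallD e₁ e₂) (e₁ + e₂)) z f
      + (2 : ℝ) • kernelIntegral (shiftCurve (wallD e₁ e₂) e₂) z f - s • f := by
  have hce : c 1 = c 0 + e₁ := by rw [hc1, hc0]
  have hA1 := coordA_e₁ he
  have hB2 := coordB_e₂ he
  have hA2 : coordA e₁ e₂ e₂ = 0 := coordA_e₂
  have hB1 : coordB e₁ e₂ e₁ = 0 := coordB_e₁
  have hAc := coordA_corner he
  have hBc := coordB_corner he
  have hz2A : coordA e₁ e₂ (z + e₂) ∈ Ico (-1 : ℝ) 0 := by rwa [coordA_add, hA2, add_zero]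
  -- None of the four shifted walls meets the upward ray from $z$: two lie strictly to one side of
  -- $z$ and two strictly below it, so a single branch of the angle serves them all.
  have hR := toC_kernelIntegral_above he (isCurve_shiftCurve (isCurve_seg _ _) e₂) (z := z)
    (c := shiftCurve (wallR e₁ e₂) e₂) (fun t ht => Or.inl (ne_of_gt (by
      simp only [shiftCurve, wallR, seg, coordA_add, coordA_sub, coordA_smul, hA1, hA2, hAc]
      linarith [hzA.2]))) f
  have hL := toC_kernelIntegral_above he (isCurve_shiftCurve (isCurve_seg _ _) (e₁ + e₂)) (z := z)
    (c := shiftCurve (wallL e₁ e₂) (e₁ + e₂)) (fun t ht => Or.inl (ne_of_lt (by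
      simp only [shiftCurve, wallL, seg, coordA_add, coordA_sub, coordA_smul, hA1, hA2, hAc]
      linarith [hzA.1]))) f
  have hD1 := toC_kernelIntegral_above he (isCurve_shiftCurve (isCurve_seg _ _) (e₁ + e₂)) (z := z)
    (c := shiftCurve (wallD e₁ e₂) (e₁ + e₂)) (fun t ht => Or.inr (by
      simp only [shiftCurve, wallD, seg, coordB_add, coordB_sub, coordB_smul, hB1, hB2, hBc]
      linarith [hzB.1])) f
  have hD2 := toC_kernelIntegral_above he (isCurve_shiftCurve (isCurve_seg _ _) e₂) (z := z)
    (c := shiftCurve (wallD e₁ e₂) e₂) (fun t ht => Or.inr (by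
      simp only [shiftCurve, wallD, seg, coordB_add, coordB_sub, coordB_smul, hB1, hB2, hBc]
      linarith [hzB.1])) f
  have hP2 := toC_kernelIntegral_two_periods hc hce hz2.not_mem f
  -- The upper pair of images is referred to $z$ by lowering the end points of the chain by $\mathbf
  -- e_2$.
  rw [logIntegral_toC_above he hc hce hcA hz2A hz2, map_add toC z e₂, rayLog_add_right,
    rayLog_add_right, ← map_sub, ← map_sub, hc0] at hP2
  have hzn : z ∉ periodicCurve e₁ c := by
    rcases hz with hz | hz
    · exact hz.1.not_mem
    · exact hz.1.not_mem
  have hP1 := toC_kernelIntegral_two_periods hc hce hzn f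
  have him : (logIntegral (fun t => toC (c t)) (toC z) +
      logIntegral (fun t => toC (c t)) (toC (z + e₁))).im =
      (rayLog (toC e₂) (toC z) (toC (corner e₁ e₂ + e₁))).im -
        (rayLog (toC e₂) (toC z) (toC (corner e₁ e₂ - e₁))).im - 2 * Real.pi * s := by
    rcases hz with ⟨hz, rfl⟩ | ⟨hz, rfl⟩
    · rw [logIntegral_toC_above he hc hce hcA hzA hz, hc0, Complex.sub_im]
      ring
    · rw [logIntegral_toC_below he hc hce hcA hzA hz, hc0, Complex.sub_im,
        rayLog_neg_im_right he, rayLog_neg_im_left he]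
      · ring
      · simp only [coordA_sub, hA1, hAc]
        linarith [hzA.1]
      · simp only [coordA_add, coordA_sub, hA1, hAc]
        linarith [hzA.2]
  rw [him, hc0] at hP1
  have r0 : shiftCurve (wallR e₁ e₂) e₂ 0 = corner e₁ e₂ + e₁ - e₂ := by
    simp [shiftCurve, wallR, seg]
  have r1 : shiftCurve (wallR e₁ e₂) e₂ 1 = corner e₁ e₂ + e₁ := by simp [shiftCurve, wallR, seg]
  have l0 : shiftCurve (wallL e₁ e₂) (e₁ + e₂) 0 = corner e₁ e₂ - e₁ - e₂ := by
    simp [shiftCurve, wallL, seg, sub_sub]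
  have l1 : shiftCurve (wallL e₁ e₂) (e₁ + e₂) 1 = corner e₁ e₂ - e₁ := by
    simp [shiftCurve, wallL, seg]
  have d0 : shiftCurve (wallD e₁ e₂) (e₁ + e₂) 0 = corner e₁ e₂ - e₁ - e₂ := by
    simp [shiftCurve, wallD, seg, sub_sub]
  have d1 : shiftCurve (wallD e₁ e₂) (e₁ + e₂) 1 = corner e₁ e₂ - e₂ := by
    simp [shiftCurve, wallD, seg]; abel
  have d2 : shiftCurve (wallD e₁ e₂) e₂ 0 = corner e₁ e₂ - e₂ := by simp [shiftCurve, wallD, seg]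
  have d3 : shiftCurve (wallD e₁ e₂) e₂ 1 = corner e₁ e₂ + e₁ - e₂ := by
    simp [shiftCurve, wallD, seg]
  rw [r0, r1] at hR
  rw [l0, l1] at hL
  rw [d0, d1] at hD1
  rw [d2, d3] at hD2
  have k1 : corner e₁ e₂ + e₁ - (z + e₂) = corner e₁ e₂ + e₁ - e₂ - z := by abel
  have k2 : corner e₁ e₂ - e₁ - (z + e₂) = corner e₁ e₂ - e₁ - e₂ - z := by abel
  rw [k1, k2, Complex.sub_im] at hP2
  apply toC.injective
  rw [map_add, hP1, hP2]
  simp only [map_add, map_sub, map_smul] at hR hL hD1 hD2 ⊢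
  rw [hR, hL, hD1, hD2]
  simp only [Complex.real_smul]
  have hpi : (Real.pi : ℂ) ≠ 0 := by exact_mod_cast Real.pi_ne_zero
  push_cast
  field_simp
  ring

end

/-! ### Path independence of the traction integral of a Stokes pair -/

theorem perp_smul (a : ℝ) (x : Plane) : perp (a • x) = a • perp x := by
  ext i
  fin_cases i <;> simp [perp]

theorem tractionIntegral_eq (c : ℝ → Plane) {T : Plane → Plane → Plane}
    (hT : ∀ x (a : ℝ) n, T x (a • n) = a • T x n) :
    tractionIntegral c T = ∫ t in (0 : ℝ)..1, T (c t) (perp (deriv c t)) := by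
  unfold tractionIntegral unitNormal
  congr 1
  ext1 t
  by_cases h : deriv c t = 0
  · have h0 : perp (0 : Plane) = (0 : ℝ) • (0 : Plane) := by
      rw [← zero_smul ℝ (0 : Plane), perp_smul, zero_smul, zero_smul]
    rw [h, norm_zero, zero_smul, h0, hT, zero_smul]
  · rw [perp_smul, hT, smul_inv_smul₀ (norm_ne_zero_iff.2 h)]

theorem traction_smul (μ : ℝ) (u : Plane → Plane) (p : Plane → ℝ) (x : Plane) (a : ℝ) (n : Plane) :
    traction μ u p x (a • n) = a • traction μ u p x n := by
  ext i
  simp [traction, Fin.sum_univ_two]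
  ring

/-- The column `j` of the stress tensor. -/
def stressColumn (μ : ℝ) (u : Plane → Plane) (p : Plane → ℝ) (j : Fin 2) (x : Plane) : Plane :=
  WithLp.toLp 2 fun i => stress μ u p x i j

/-- The traction with respect to the normal of a directed line element, as a `1`-form. -/
def tractionForm (μ : ℝ) (u : Plane → Plane) (p : Plane → ℝ) (x : Plane) : Plane →L[ℝ] Plane :=
  (EuclideanSpace.proj 0 : Plane →L[ℝ] ℝ).smulRight (stressColumn μ u p 1 x) -
    (EuclideanSpace.proj 1 : Plane →L[ℝ] ℝ).smulRight (stressColumn μ u p 0 x)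

theorem tractionForm_apply (μ : ℝ) (u : Plane → Plane) (p : Plane → ℝ) (x h : Plane) :
    tractionForm μ u p x h = traction μ u p x (perp h) := by
  ext i
  simp [tractionForm, traction, perp, stressColumn, Fin.sum_univ_two]
  ring

theorem two_le_infty : (2 : WithTop ℕ∞) ≤ ∞ := by
  rw [show (2 : WithTop ℕ∞) = ((2 : ℕ∞) : WithTop ℕ∞) from rfl]
  exact WithTop.coe_le_coe.2 le_top

section

variable {μ : ℝ} {u : Plane → Plane} {p : Plane → ℝ} {x : Plane}

theorem hasFDerivAt_pderiv (hu : ContDiffAt ℝ ∞ u x) (j i : Fin 2) :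
    HasFDerivAt (pderiv u j i) ((EuclideanSpace.proj i : Plane →L[ℝ] ℝ) ∘L
      (fderiv ℝ (fderiv ℝ u) x).flip (EuclideanSpace.single j 1)) x := by
  have hd : DifferentiableAt ℝ (fderiv ℝ u) x :=
    (hu.fderiv_right (m := 1) (by rw [one_add_one_eq_two]; exact two_le_infty)).differentiableAt
      one_ne_zero
  have h1 : HasFDerivAt (fun y => fderiv ℝ u y (EuclideanSpace.single j 1))
      ((fderiv ℝ (fderiv ℝ u) x).flip (EuclideanSpace.single j 1)) x :=
    HasFDerivAt.congr_fderiv (f := fun y => fderiv ℝ u y (EuclideanSpace.single j 1))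
      ((ContinuousLinearMap.apply ℝ Plane
        (EuclideanSpace.single j (1 : ℝ) : Plane)).hasFDerivAt.comp x hd.hasFDerivAt) (by ext; rfl)
  exact (EuclideanSpace.proj i : Plane →L[ℝ] ℝ).hasFDerivAt.comp x h1

theorem hasFDerivAt_stress (hu : ContDiffAt ℝ ∞ u x) (hp : DifferentiableAt ℝ p x) (i j : Fin 2) :
    HasFDerivAt (fun y => stress μ u p y i j) ((if i = j then -fderiv ℝ p x else 0) +
      μ • ((EuclideanSpace.proj i : Plane →L[ℝ] ℝ) ∘L
        (fderiv ℝ (fderiv ℝ u) x).flip (EuclideanSpace.single j 1) +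
      (EuclideanSpace.proj j : Plane →L[ℝ] ℝ) ∘L
        (fderiv ℝ (fderiv ℝ u) x).flip (EuclideanSpace.single i 1))) x := by
  simp only [stress, Matrix.of_apply]
  refine HasFDerivAt.add ?_
    (((hasFDerivAt_pderiv hu j i).add (hasFDerivAt_pderiv hu i j)).const_mul μ)
  split_ifs
  · exact hp.hasFDerivAt.neg
  · exact hasFDerivAt_const 0 x

theorem differentiableAt_stressColumn (hu : ContDiffAt ℝ ∞ u x) (hp : DifferentiableAt ℝ p x)
    (j : Fin 2) : DifferentiableAt ℝ (stressColumn μ u p j) x :=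
  differentiableAt_euclidean.2 fun i => (hasFDerivAt_stress hu hp i j).differentiableAt

theorem fderiv_stressColumn (hu : ContDiffAt ℝ ∞ u x) (hp : DifferentiableAt ℝ p x)
    (i j : Fin 2) (k : Plane) :
    (fderiv ℝ (stressColumn μ u p j) x k) i = (if i = j then -fderiv ℝ p x k else 0) +
      μ * ((fderiv ℝ (fderiv ℝ u) x k (EuclideanSpace.single j 1)) i +
        (fderiv ℝ (fderiv ℝ u) x k (EuclideanSpace.single i 1)) j) := by
  have h1 := (EuclideanSpace.proj i : Plane →L[ℝ] ℝ).hasFDerivAt.comp x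
    (differentiableAt_stressColumn (μ := μ) hu hp j).hasFDerivAt
  have h2 := h1.unique (hasFDerivAt_stress hu hp i j)
  have h3 := congrArg (fun A : Plane →L[ℝ] ℝ => A k) h2
  simp only at h3
  split_ifs at h3 ⊢ <;> simpa [mul_add] using h3

theorem div_stress {W : Set Plane} (hW : IsOpen W) (h : IsStokesPair μ W u p) (hx : x ∈ W) :
    fderiv ℝ (stressColumn μ u p 0) x (EuclideanSpace.single 0 1) +
      fderiv ℝ (stressColumn μ u p 1) x (EuclideanSpace.single 1 1) = 0 := by
  obtain ⟨hu, hp, hst⟩ := h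
  have hux : ContDiffAt ℝ ∞ u x := hu.contDiffAt (hW.mem_nhds hx)
  have hpx : DifferentiableAt ℝ p x :=
    (hp.contDiffAt (hW.mem_nhds hx)).differentiableAt (by simp)
  have hsym : ∀ a b, fderiv ℝ (fderiv ℝ u) x a b = fderiv ℝ (fderiv ℝ u) x b a :=
    fun a b => (hux.isSymmSndFDerivAt (by simpa using two_le_infty)).eq a b
  have hdiv : ∀ k : Plane, ∑ i, (fderiv ℝ (fderiv ℝ u) x k (EuclideanSpace.single i 1)) i = 0 := by
    intro k
    have h1 : HasFDerivAt (fun y => ∑ i, pderiv u i i y) _ x :=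
      HasFDerivAt.fun_sum fun i _ => hasFDerivAt_pderiv hux i i
    have h2 : HasFDerivAt (fun y => ∑ i, pderiv u i i y) (0 : Plane →L[ℝ] ℝ) x :=
      (hasFDerivAt_const (0 : ℝ) x).congr_of_eventuallyEq
        (eventually_of_mem (hW.mem_nhds hx) fun y hy => (hst y hy).2)
    have h3 := congrArg (fun A : Plane →L[ℝ] ℝ => A k) (h1.unique h2)
    simpa using h3
  have hlap : Δ u x = ∑ i : Fin 2, fderiv ℝ (fderiv ℝ u) x (EuclideanSpace.single i 1)
      (EuclideanSpace.single i 1) := by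
    rw [InnerProductSpace.laplacian_eq_iteratedFDeriv_orthonormalBasis u
      (EuclideanSpace.basisFun (Fin 2) ℝ)]
    simp [iteratedFDeriv_two_apply]
  have hgrad : ∀ i, (∇ p x) i = fderiv ℝ p x (EuclideanSpace.single i 1) := by
    intro i
    have : ⟪∇ p x, EuclideanSpace.single i (1 : ℝ)⟫_ℝ = fderiv ℝ p x (EuclideanSpace.single i 1) :=
      InnerProductSpace.toDual_symm_apply
    rw [← this, EuclideanSpace.inner_single_right]
    simp
  have hmom := (hst x hx).1
  rw [hlap] at hmom
  ext i
  have hmi := congrArg (fun w : Plane => w i) hmom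
  have hd0 := hdiv (EuclideanSpace.single 0 1)
  have hd1 := hdiv (EuclideanSpace.single 1 1)
  have hs := hsym (EuclideanSpace.single 0 1) (EuclideanSpace.single 1 1)
  rw [PiLp.add_apply, fderiv_stressColumn hux hpx, fderiv_stressColumn hux hpx]
  simp only [Fin.sum_univ_two, PiLp.add_apply, PiLp.neg_apply, PiLp.smul_apply, hgrad,
    PiLp.zero_apply, smul_eq_mul] at hmi hd0 hd1 ⊢
  fin_cases i
  · simp only [Fin.zero_eta, Fin.isValue, if_true, zero_ne_one, if_false] at hmi ⊢
    rw [hs] at hd0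
    linear_combination -hmi + μ * hd0
  · simp only [Fin.mk_one, Fin.isValue, if_true, one_ne_zero, if_false] at hmi ⊢
    rw [hs]
    linear_combination -hmi + μ * hd1

theorem differentiableAt_tractionForm (hu : ContDiffAt ℝ ∞ u x) (hp : DifferentiableAt ℝ p x) :
    HasFDerivAt (tractionForm μ u p)
      ((ContinuousLinearMap.smulRightL ℝ Plane Plane (EuclideanSpace.proj 0)) ∘L
          fderiv ℝ (stressColumn μ u p 1) x -
        (ContinuousLinearMap.smulRightL ℝ Plane Plane (EuclideanSpace.proj 1)) ∘L
          fderiv ℝ (stressColumn μ u p 0) x) x := by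
  have h := fun j => (differentiableAt_stressColumn (μ := μ) hu hp j).hasFDerivAt
  exact ((ContinuousLinearMap.smulRightL ℝ Plane Plane
      (EuclideanSpace.proj 0)).hasFDerivAt.comp x (h 1)).sub
    ((ContinuousLinearMap.smulRightL ℝ Plane Plane
      (EuclideanSpace.proj 1)).hasFDerivAt.comp x (h 0))

theorem fderiv_tractionForm_symm {W : Set Plane} (hW : IsOpen W) (h : IsStokesPair μ W u p)
    (hx : x ∈ W) (a b : Plane) :
    fderiv ℝ (tractionForm μ u p) x a b = fderiv ℝ (tractionForm μ u p) x b a := by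
  have hux : ContDiffAt ℝ ∞ u x := h.1.contDiffAt (hW.mem_nhds hx)
  have hpx : DifferentiableAt ℝ p x :=
    (h.2.1.contDiffAt (hW.mem_nhds hx)).differentiableAt (by simp)
  have hexp : ∀ k : Plane, k = k 0 • EuclideanSpace.single 0 (1 : ℝ) +
      k 1 • EuclideanSpace.single 1 (1 : ℝ) := by
    intro k
    ext i
    fin_cases i <;> simp
  have hF : ∀ (A : Plane →L[ℝ] Plane) (k : Plane), A k =
      k 0 • A (EuclideanSpace.single 0 1) + k 1 • A (EuclideanSpace.single 1 1) := by
    intro A k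
    conv_lhs => rw [hexp k]
    simp
  rw [(differentiableAt_tractionForm hux hpx).fderiv]
  simp only [sub_apply, ContinuousLinearMap.comp_apply,
    ContinuousLinearMap.smulRightL_apply_apply, ContinuousLinearMap.smulRight_apply]
  have hdiv := eq_neg_of_add_eq_zero_left (div_stress hW h hx)
  rw [hF (fderiv ℝ (stressColumn μ u p 0) x) a, hF (fderiv ℝ (stressColumn μ u p 0) x) b,
    hF (fderiv ℝ (stressColumn μ u p 1) x) a, hF (fderiv ℝ (stressColumn μ u p 1) x) b, hdiv]
  simp only [PiLp.proj_apply]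
  module

end

theorem IsStokesPair.intervalIntegrable {μ : ℝ} {W : Set Plane} {u : Plane → Plane}
    {p : Plane → ℝ} (hW : IsOpen W) (h : IsStokesPair μ W u p)
    {c : ℝ → Plane} (hc : IsCurve c) (hcW : ∀ t ∈ Icc (0 : ℝ) 1, c t ∈ W) :
    IntervalIntegrable (fun t => traction μ u p (c t) (perp (deriv c t))) volume 0 1 := by
  simp only [← tractionForm_apply]
  refine hc.intervalIntegrable_clm fun t ht => ?_
  have hn := hW.mem_nhds (hcW t ht)
  exact (differentiableAt_tractionForm (h.1.contDiffAt hn) ((h.2.1.contDiffAt hn).differentiableAt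
    (by simp))).continuousAt.comp_continuousWithinAt (hc.continuousOn t ht)

/-- The traction integral of a Stokes pair in a convex set depends on the end points only. -/
theorem IsStokesPair.integral_eq {μ : ℝ} {W : Set Plane} {u : Plane → Plane}
    {p : Plane → ℝ} (hW : IsOpen W) (hWc : Convex ℝ W) (h : IsStokesPair μ W u p)
    {c c' : ℝ → Plane} (hc : IsCurve c) (hcW : ∀ t ∈ Icc (0 : ℝ) 1, c t ∈ W)
    (hc' : IsCurve c') (hcW' : ∀ t ∈ Icc (0 : ℝ) 1, c' t ∈ W) (h0 : c 0 = c' 0) (h1 : c 1 = c' 1) :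
    ∫ t in (0 : ℝ)..1, traction μ u p (c t) (perp (deriv c t)) =
      ∫ t in (0 : ℝ)..1, traction μ u p (c' t) (perp (deriv c' t)) := by
  have hd : ∀ x ∈ W, DifferentiableAt ℝ (tractionForm μ u p) x := fun x hx =>
    (differentiableAt_tractionForm (h.1.contDiffAt (hW.mem_nhds hx))
      ((h.2.1.contDiffAt (hW.mem_nhds hx)).differentiableAt (by simp))).differentiableAt
  obtain ⟨F, hF⟩ := hWc.exists_forall_hasFDerivAt_of_fderiv_symmetric hW
    (fun x hx => (hd x hx).differentiableWithinAt)
    (fun x hx a b => fderiv_tractionForm_symm hW h hx a b)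
  have key : ∀ c : ℝ → Plane, IsCurve c → (∀ t ∈ Icc (0 : ℝ) 1, c t ∈ W) →
      ∫ t in (0 : ℝ)..1, traction μ u p (c t) (perp (deriv c t)) = F (c 1) - F (c 0) := by
    intro c hc hcW
    simp only [← tractionForm_apply]
    exact hc.integral_clm (fun t ht => hF _ (hcW t ht)) fun t ht =>
      (hd _ (hcW t ht)).continuousAt.comp_continuousWithinAt (hc.continuousOn t ht)
  rw [key c hc hcW, key c' hc' hcW', h0, h1]

/-! ### The traction kernel: bounds, measurability, exchange of integrals -/

theorem tractionKernel_smul (x : Plane) (a : ℝ) (n z f : Plane) :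
    tractionKernel x (a • n) z f = a • tractionKernel x n z f := by
  rw [tractionKernel, tractionKernel, inner_smul_right, smul_smul]
  congr 1
  ring

theorem norm_tractionKernel_le (x n z f : Plane) :
    ‖tractionKernel x n z f‖ ≤ ‖f‖ * ‖n‖ / ‖x - z‖ := by
  rw [tractionKernel, norm_smul]
  by_cases h0 : x - z = 0
  · simp [h0]
  have hr : 0 < ‖x - z‖ := norm_pos_iff.2 h0
  have hpi : |(-(1 / Real.pi))| ≤ 1 := by
    rw [abs_neg, abs_of_pos (by positivity), div_le_one Real.pi_pos]
    linarith [Real.pi_gt_three]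
  have h1 := abs_real_inner_le_norm (x - z) f
  have h2 := abs_real_inner_le_norm (x - z) n
  rw [norm_mul, norm_mul, norm_div, norm_div, norm_pow, norm_norm, Real.norm_eq_abs,
    Real.norm_eq_abs, Real.norm_eq_abs]
  calc |(-(1 / Real.pi))| * (|⟪x - z, f⟫_ℝ| / ‖x - z‖ ^ 2) * (|⟪x - z, n⟫_ℝ| / ‖x - z‖ ^ 2)
        * ‖x - z‖
      ≤ 1 * (‖x - z‖ * ‖f‖ / ‖x - z‖ ^ 2) * (‖x - z‖ * ‖n‖ / ‖x - z‖ ^ 2) * ‖x - z‖ := by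
        gcongr
    _ = ‖f‖ * ‖n‖ / ‖x - z‖ := by
        field_simp

theorem measurable_tractionKernel : Measurable
    (fun p : (Plane × Plane) × Plane × Plane => tractionKernel p.1.1 p.1.2 p.2.1 p.2.2) := by
  unfold tractionKernel
  fun_prop

theorem continuous_perp : Continuous perp := by
  unfold perp
  fun_prop

theorem norm_perp (x : Plane) : ‖perp x‖ = ‖x‖ := by
  rw [EuclideanSpace.norm_eq, EuclideanSpace.norm_eq]
  simp [perp, add_comm]

section

variable {S : Set Plane} {σ : Plane → Plane} {M δ : ℝ} {w : Plane} {c : ℝ → Plane}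

theorem integrableOn_tractionKernel [IsFiniteMeasure ((μH[1] : Measure Plane).restrict S)]
    (hS : MeasurableSet S) (hσ : AEStronglyMeasurable σ ((μH[1] : Measure Plane).restrict S))
    (hM : ∀ y ∈ S, ‖σ y‖ ≤ M) (hδ : 0 < δ) {x : Plane} (hx : ∀ y ∈ S, δ ≤ ‖x - (y + w)‖)
    (n : Plane) : IntegrableOn (fun y => tractionKernel x n (y + w) (σ y)) S μH[1] := by
  refine Integrable.of_bound (C := M * ‖n‖ / δ) ?_ ?_
  · refine (measurable_tractionKernel.comp_aemeasurable
      (f := fun y => ((x, n), (y + w, σ y))) ?_).aestronglyMeasurable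
    exact aemeasurable_const.prodMk
      ((measurable_id.add_const w).aemeasurable.prodMk hσ.aemeasurable)
  · filter_upwards [ae_restrict_mem hS] with y hy
    refine (norm_tractionKernel_le _ _ _ _).trans ?_
    have := hx y hy
    have := hM y hy
    have h0 : 0 ≤ M := (norm_nonneg _).trans this
    gcongr

theorem integrable_prod_tractionKernel [IsFiniteMeasure ((μH[1] : Measure Plane).restrict S)]
    (hS : MeasurableSet S) (hσ : AEStronglyMeasurable σ ((μH[1] : Measure Plane).restrict S))
    (hM : ∀ y ∈ S, ‖σ y‖ ≤ M) (hc : IsCurve c) (hδ : 0 < δ)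
    (hx : ∀ t ∈ Icc (0 : ℝ) 1, ∀ y ∈ S, δ ≤ ‖c t - (y + w)‖) :
    Integrable (fun p : ℝ × Plane => tractionKernel (c p.1) (perp (deriv c p.1)) (p.2 + w) (σ p.2))
      (((volume : Measure ℝ).restrict (Ioc 0 1)).prod ((μH[1] : Measure Plane).restrict S)) := by
  have hdi : Integrable (fun t => ‖deriv c t‖) ((volume : Measure ℝ).restrict (Ioc 0 1)) :=
    ((intervalIntegrable_iff_integrableOn_Ioc_of_le zero_le_one).1 hc.integrable).norm
  have hg := hdi.mul_prod (integrable_const (μ := (μH[1] : Measure Plane).restrict S) (M / δ))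
  refine hg.mono' ?_ ?_
  · have hcm : AEMeasurable c ((volume : Measure ℝ).restrict (Ioc 0 1)) :=
      (hc.continuousOn.mono Ioc_subset_Icc_self).aemeasurable measurableSet_Ioc
    have hdm : Measurable fun t => perp (deriv c t) :=
      continuous_perp.measurable.comp (measurable_deriv c)
    have h1 := (hcm.prodMk hdm.aemeasurable).comp_quasiMeasurePreserving
      (Measure.quasiMeasurePreserving_fst (ν := (μH[1] : Measure Plane).restrict S))
    have h2 := ((measurable_id.add_const w).aemeasurable.prodMk
      hσ.aemeasurable).comp_quasiMeasurePreserving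
      (Measure.quasiMeasurePreserving_snd (μ := (volume : Measure ℝ).restrict (Ioc 0 1)))
    exact (measurable_tractionKernel.comp_aemeasurable (h1.prodMk h2)).aestronglyMeasurable
  · filter_upwards [(Measure.quasiMeasurePreserving_fst
        (ν := (μH[1] : Measure Plane).restrict S)).ae (ae_restrict_mem measurableSet_Ioc),
      (Measure.quasiMeasurePreserving_snd
        (μ := (volume : Measure ℝ).restrict (Ioc 0 1))).ae (ae_restrict_mem hS)] with p hp1 hp2
    refine (norm_tractionKernel_le _ _ _ _).trans ?_
    rw [norm_perp]
    have h1 := hx p.1 (Ioc_subset_Icc_self hp1) p.2 hp2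
    have h2 := hM p.2 hp2
    have h0 : 0 ≤ M := (norm_nonneg _).trans h2
    calc ‖σ p.2‖ * ‖deriv c p.1‖ / ‖c p.1 - (p.2 + w)‖ ≤ M * ‖deriv c p.1‖ / δ := by gcongr
      _ = ‖deriv c p.1‖ * (M / δ) := by ring

theorem intervalIntegrable_integral_tractionKernel
    [IsFiniteMeasure ((μH[1] : Measure Plane).restrict S)]
    (hS : MeasurableSet S) (hσ : AEStronglyMeasurable σ ((μH[1] : Measure Plane).restrict S))
    (hM : ∀ y ∈ S, ‖σ y‖ ≤ M) (hc : IsCurve c) (hδ : 0 < δ)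
    (hx : ∀ t ∈ Icc (0 : ℝ) 1, ∀ y ∈ S, δ ≤ ‖c t - (y + w)‖) :
    IntervalIntegrable
      (fun t => ∫ y in S, tractionKernel (c t) (perp (deriv c t)) (y + w) (σ y) ∂μH[1])
      volume 0 1 :=
  (intervalIntegrable_iff_integrableOn_Ioc_of_le zero_le_one).2
    (integrable_prod_tractionKernel hS hσ hM hc hδ hx).integral_prod_left

theorem integrableOn_kernelIntegral
    [IsFiniteMeasure ((μH[1] : Measure Plane).restrict S)]
    (hS : MeasurableSet S) (hσ : AEStronglyMeasurable σ ((μH[1] : Measure Plane).restrict S))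
    (hM : ∀ y ∈ S, ‖σ y‖ ≤ M) (hc : IsCurve c) (hδ : 0 < δ)
    (hx : ∀ t ∈ Icc (0 : ℝ) 1, ∀ y ∈ S, δ ≤ ‖c t - (y + w)‖) :
    IntegrableOn (fun y => kernelIntegral c (y + w) (σ y)) S μH[1] := by
  have := (integrable_prod_tractionKernel hS hσ hM hc hδ hx).integral_prod_right
  simpa only [kernelIntegral, intervalIntegral.integral_of_le zero_le_one] using! this

theorem integral_integral_tractionKernel
    [IsFiniteMeasure ((μH[1] : Measure Plane).restrict S)]
    (hS : MeasurableSet S) (hσ : AEStronglyMeasurable σ ((μH[1] : Measure Plane).restrict S))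
    (hM : ∀ y ∈ S, ‖σ y‖ ≤ M) (hc : IsCurve c) (hδ : 0 < δ)
    (hx : ∀ t ∈ Icc (0 : ℝ) 1, ∀ y ∈ S, δ ≤ ‖c t - (y + w)‖) :
    ∫ t in (0 : ℝ)..1, ∫ y in S, tractionKernel (c t) (perp (deriv c t)) (y + w) (σ y) ∂μH[1] =
      ∫ y in S, kernelIntegral c (y + w) (σ y) ∂μH[1] := by
  simp only [kernelIntegral, intervalIntegral.integral_of_le zero_le_one]
  exact integral_integral_swap (integrable_prod_tractionKernel hS hσ hM hc hδ hx)

end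

/-! ### Lattice images -/

section

variable {e₁ e₂ : Plane}

theorem latticeVec_add (m k m' k' : ℤ) :
    latticeVec e₁ e₂ m k + latticeVec e₁ e₂ m' k' = latticeVec e₁ e₂ (m + m') (k + k') := by
  simp only [latticeVec]
  push_cast
  module

theorem coordA_latticeVec (he : 0 < cross e₁ e₂) (m k : ℤ) :
    coordA e₁ e₂ (latticeVec e₁ e₂ m k) = m := by
  rw [latticeVec, coordA_add, coordA_smul, coordA_smul, coordA_e₁ he, coordA_e₂]
  ring

theorem coordB_latticeVec (he : 0 < cross e₁ e₂) (m k : ℤ) :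
    coordB e₁ e₂ (latticeVec e₁ e₂ m k) = k := by
  rw [latticeVec, coordB_add, coordB_smul, coordB_smul, coordB_e₁, coordB_e₂ he]
  ring

/-- The near sum over the four images, indexed by the image in the lower left quadrant. -/
theorem nearSum_eq (he : 0 < cross e₁ e₂) (K : Plane → Plane) {z : Plane}
    (hzA : coordA e₁ e₂ z ∈ Ico (-1 : ℝ) 0) (hzB : coordB e₁ e₂ z ∈ Ico (-1 : ℝ) 0) (m k : ℤ) :
    nearSum e₁ e₂ K (z + latticeVec e₁ e₂ m k) =
      (K z + K (z + e₁)) + (K (z + e₂) + K (z + e₂ + e₁)) := by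
  have hset : ∀ j : ℤ × ℤ,
      z + latticeVec e₁ e₂ m k + latticeVec e₁ e₂ j.1 j.2 ∈ expandedCell e₁ e₂ ↔
        j ∈ (({-m, 1 - m} : Finset ℤ) ×ˢ ({-k, 1 - k} : Finset ℤ)) := by
    have key : ∀ (a : ℝ) (n : ℤ), a ∈ Ico (-1 : ℝ) 0 →
        (a + n ∈ Ico (-1 : ℝ) 1 ↔ n = 0 ∨ n = 1) := by
      intro a n ha
      constructor
      · rintro ⟨h1, h2⟩
        have h3 : (-1 : ℝ) < n := by linarith [ha.2]
        have h4 : (n : ℝ) < 2 := by linarith [ha.1]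
        have h3' : -1 < n := by exact_mod_cast h3
        have h4' : n < 2 := by exact_mod_cast h4
        omega
      · rintro (rfl | rfl)
        · exact ⟨by simpa using ha.1, by push_cast; linarith [ha.2]⟩
        · exact ⟨by push_cast; linarith [ha.1], by push_cast; linarith [ha.2]⟩
    intro j
    rw [add_assoc, latticeVec_add, expandedCell, mem_ofPred_eq, coordA_add, coordB_add,
      coordA_latticeVec he, coordB_latticeVec he, key _ _ hzA, key _ _ hzB]
    simp only [Finset.mem_product, Finset.mem_insert, Finset.mem_singleton]
    omega
  unfold nearSum
  simp only [hset]
  rw [finsum_mem_finset_eq_sum, Finset.sum_product, Finset.sum_pair (by omega),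
    Finset.sum_pair (by omega), Finset.sum_pair (by omega)]
  simp only [add_assoc, latticeVec_add]
  simp [latticeVec]
  rw [add_comm e₂ e₁]
  abel

theorem LiesAbove.add_e₁ {c : ℝ → Plane} {x : Plane} (h : LiesAbove e₁ e₂ c x) (m : ℤ) :
    LiesAbove e₁ e₂ c (x + (m : ℝ) • e₁) := by
  obtain ⟨z, ⟨γ, hγ⟩, hz⟩ := h
  refine ⟨z + (m : ℝ) • e₁, ⟨γ.map (continuous_add_const ((m : ℝ) • e₁)), ?_⟩, fun w hw => ?_⟩
  · rintro s ⟨l, t, ht, heq⟩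
    refine hγ s ⟨l - m, t, ht, ?_⟩
    rw [Path.map_coe, Function.comp_apply] at heq
    rw [eq_sub_of_add_eq heq]
    push_cast
    module
  · rw [coordB_add, coordB_smul, coordB_e₁]
    linarith [hz w hw]

theorem LiesBelow.add_e₁ {c : ℝ → Plane} {x : Plane} (h : LiesBelow e₁ e₂ c x) (m : ℤ) :
    LiesBelow e₁ e₂ c (x + (m : ℝ) • e₁) := by
  obtain ⟨z, ⟨γ, hγ⟩, hz⟩ := h
  refine ⟨z + (m : ℝ) • e₁, ⟨γ.map (continuous_add_const ((m : ℝ) • e₁)), ?_⟩, fun w hw => ?_⟩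
  · rintro s ⟨l, t, ht, heq⟩
    refine hγ s ⟨l - m, t, ht, ?_⟩
    rw [Path.map_coe, Function.comp_apply] at heq
    rw [eq_sub_of_add_eq heq]
    push_cast
    module
  · rw [coordB_add, coordB_smul, coordB_e₁]
    linarith [hz w hw]

/-- The lattice coordinates of the vectors subtracted from the four pieces. -/
def pieceIndex : Fin 4 → ℤ × ℤ := ![(1, 1), (0, 1), (0, 0), (1, 0)]

theorem pieceIndex_injective : Function.Injective pieceIndex := by decide

theorem pieceShift_eq (i : Fin 4) :
    pieceShift e₁ e₂ i = latticeVec e₁ e₂ (pieceIndex i).1 (pieceIndex i).2 := by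
  fin_cases i <;> simp [pieceShift, pieceIndex, latticeVec]

theorem mem_quadrant_shift (he : 0 < cross e₁ e₂) {y : Plane} (hy : y ∈ expandedCell e₁ e₂)
    {i : Fin 4} (hi : y ∈ quadrant e₁ e₂ i) :
    coordA e₁ e₂ (y - pieceShift e₁ e₂ i) ∈ Ico (-1 : ℝ) 0 ∧
      coordB e₁ e₂ (y - pieceShift e₁ e₂ i) ∈ Ico (-1 : ℝ) 0 := by
  rw [pieceShift_eq, coordA_sub, coordB_sub, coordA_latticeVec he, coordB_latticeVec he]
  obtain ⟨⟨h1, h2⟩, h3, h4⟩ := hy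
  fin_cases i <;> simp [quadrant] at hi <;> simp [pieceIndex] <;>
    refine ⟨⟨?_, ?_⟩, ?_, ?_⟩ <;> linarith

theorem measurableSet_quadrant (i : Fin 4) : MeasurableSet (quadrant e₁ e₂ i) := by
  have hA : Measurable (coordA e₁ e₂) := continuous_coordA.measurable
  have hB : Measurable (coordB e₁ e₂) := continuous_coordB.measurable
  fin_cases i
  · exact (measurableSet_le measurable_const hA).inter (measurableSet_le measurable_const hB)
  · exact (measurableSet_lt hA measurable_const).inter (measurableSet_le measurable_const hB)
  · exact (measurableSet_lt hA measurable_const).inter (measurableSet_lt hB measurable_const)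
  · exact (measurableSet_le measurable_const hA).inter (measurableSet_lt hB measurable_const)

theorem iUnion_piece (Γ : Set Plane) : ⋃ i, piece e₁ e₂ Γ i = Γ := by
  refine subset_antisymm (iUnion_subset fun i => inter_subset_left) fun y hy => ?_
  rw [mem_iUnion]
  rcases le_or_gt 0 (coordA e₁ e₂ y) with ha | ha <;>
    rcases le_or_gt 0 (coordB e₁ e₂ y) with hb | hb
  · exact ⟨0, hy, ha, hb⟩
  · exact ⟨3, hy, ha, hb⟩
  · exact ⟨1, hy, ha, hb⟩
  · exact ⟨2, hy, ha, hb⟩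

theorem pairwise_disjoint_piece (Γ : Set Plane) :
    Pairwise (Function.onFun Disjoint (piece e₁ e₂ Γ)) := by
  intro i j hij
  rw [Function.onFun, Set.disjoint_left]
  rintro y ⟨-, hi⟩ ⟨-, hj⟩
  fin_cases i <;> fin_cases j <;> simp [quadrant] at hi hj hij <;> linarith

end

/-! ### The boundary of a particle and its pieces -/

section

variable {e₁ e₂ : Plane} {Ω : Set Plane} {σ : Plane → Plane}

theorem IsSmoothClosedCurve.isCompact {Γ : Set Plane} (h : IsSmoothClosedCurve Γ) :
    IsCompact Γ := by
  obtain ⟨γ, hγ, hper, -, -, rfl⟩ := h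
  rw [← hper.image_Icc one_pos 0]
  exact isCompact_Icc.image hγ.continuous

theorem IsSmoothClosedCurve.hausdorffMeasure_lt_top {Γ : Set Plane} (h : IsSmoothClosedCurve Γ) :
    μH[1] Γ < ⊤ := by
  obtain ⟨γ, hγ, hper, -, -, rfl⟩ := h
  rw [← hper.image_Icc one_pos 0]
  have h1 : ContDiff ℝ 1 γ := hγ.of_le (by simp)
  obtain ⟨K, hK⟩ := LocallyLipschitzOn.exists_lipschitzOnWith_of_compact
    (isCompact_Icc (a := (0 : ℝ)) (b := 0 + 1)) (h1.locallyLipschitz.locallyLipschitzOn)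
  refine (hK.hausdorffMeasure_image_le zero_le_one).trans_lt ?_
  rw [hausdorffMeasure_real, Real.volume_Icc]
  exact ENNReal.mul_lt_top (by simp) ENNReal.ofReal_lt_top

theorem IsParticle.frontier_subset (hΩ : IsParticle e₁ e₂ Ω) :
    frontier Ω ⊆ expandedCell e₁ e₂ :=
  frontier_subset_closure.trans hΩ.subset

/-- The density on a piece of the boundary of a particle is bounded and measurable. -/
structure IsPieceDensity (σ : Plane → Plane) (S : Set Plane) (M : ℝ) : Prop where
  measurableSet : MeasurableSet S
  isFinite : IsFiniteMeasure ((μH[1] : Measure Plane).restrict S)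
  aestronglyMeasurable : AEStronglyMeasurable σ ((μH[1] : Measure Plane).restrict S)
  bound : ∀ y ∈ S, ‖σ y‖ ≤ M

theorem IsPieceDensity.integrableOn {S : Set Plane} {M : ℝ} (h : IsPieceDensity σ S M) :
    IntegrableOn σ S μH[1] := by
  have := h.isFinite
  exact Integrable.of_bound h.aestronglyMeasurable M
    ((ae_restrict_mem h.measurableSet).mono h.bound)

theorem IsParticle.exists_isPieceDensity (hΩ : IsParticle e₁ e₂ Ω)
    (hσ : ContinuousOn σ (frontier Ω)) :
    ∃ M, ∀ i, IsPieceDensity σ (piece e₁ e₂ (frontier Ω) i) M := by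
  have hK := hΩ.boundary.isCompact
  obtain ⟨M, hM⟩ := hK.exists_bound_of_continuousOn hσ
  have hm : ∀ i, MeasurableSet (piece e₁ e₂ (frontier Ω) i) := fun i =>
    hK.measurableSet.inter (measurableSet_quadrant i)
  refine ⟨M, fun i => ⟨hm i, ⟨?_⟩, (hσ.mono inter_subset_left).aestronglyMeasurable (hm i),
    fun y hy => hM y hy.1⟩⟩
  rw [Measure.restrict_apply_univ]
  exact (measure_mono inter_subset_left).trans_lt hΩ.boundary.hausdorffMeasure_lt_top

/-- The vector that carries a point of the piece `i` to its image in the lower left quadrant,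
followed by the lattice vector `a e₁ + b e₂`. -/
def imageVec (e₁ e₂ : Plane) (i : Fin 4) (a b : ℤ) : Plane :=
  latticeVec e₁ e₂ (a - (pieceIndex i).1) (b - (pieceIndex i).2)

theorem add_imageVec (y : Plane) (i : Fin 4) (a b : ℤ) :
    y + imageVec e₁ e₂ i a b = y - pieceShift e₁ e₂ i + (b : ℝ) • e₂ + (a : ℝ) • e₁ := by
  rw [pieceShift_eq]
  simp only [imageVec, latticeVec]
  push_cast
  module

theorem nearSum_piece (he : 0 < cross e₁ e₂) (hΩ : IsParticle e₁ e₂ Ω) (K : Plane → Plane)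
    {i : Fin 4} {y : Plane} (hy : y ∈ piece e₁ e₂ (frontier Ω) i) :
    nearSum e₁ e₂ K y =
      (K (y + imageVec e₁ e₂ i 0 0) + K (y + imageVec e₁ e₂ i 1 0)) +
        (K (y + imageVec e₁ e₂ i 0 1) + K (y + imageVec e₁ e₂ i 1 1)) := by
  obtain ⟨hA, hB⟩ := mem_quadrant_shift he (hΩ.frontier_subset hy.1) hy.2
  have := nearSum_eq he K hA hB (pieceIndex i).1 (pieceIndex i).2
  rw [← pieceShift_eq, sub_add_cancel] at this
  rw [this]
  simp [add_imageVec]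

theorem integral_add_four {α : Type*} [MeasurableSpace α] {ν : Measure α} {f g h k : α → Plane}
    (hf : Integrable f ν) (hg : Integrable g ν) (hh : Integrable h ν) (hk : Integrable k ν) :
    ∫ x, ((f x + g x) + (h x + k x)) ∂ν =
      ((∫ x, f x ∂ν) + ∫ x, g x ∂ν) + ((∫ x, h x ∂ν) + ∫ x, k x ∂ν) := by
  rw [← integral_add hf hg, ← integral_add hh hk]
  exact integral_add (hf.add hg) (hh.add hk)

/-! ### Exchange of the integrals over the curve and over the boundary -/

/-- Source points and curve have positive distance. -/
def Separated (c : ℝ → Plane) (S : Set Plane) (w : Plane) : Prop :=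
  ∃ δ > 0, ∀ t ∈ Icc (0 : ℝ) 1, ∀ y ∈ S, δ ≤ ‖c t - (y + w)‖

/-- `∫_S Gᵗ(c(t), y + w) σ(y) ds_y` for the normal `c'(t)^⊥`. -/
def pieceTraction (c : ℝ → Plane) (S : Set Plane) (σ : Plane → Plane) (w : Plane) (t : ℝ) : Plane :=
  ∫ y in S, tractionKernel (c t) (perp (deriv c t)) (y + w) (σ y) ∂μH[1]

theorem intervalIntegrable_pieceTraction {S : Set Plane} {M : ℝ} (h : IsPieceDensity σ S M)
    {c : ℝ → Plane} (hc : IsCurve c) {w : Plane} (hs : Separated c S w) :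
    IntervalIntegrable (pieceTraction c S σ w) volume 0 1 := by
  obtain ⟨δ, hδ, hx⟩ := hs
  have := h.isFinite
  exact intervalIntegrable_integral_tractionKernel h.measurableSet h.aestronglyMeasurable h.bound
    hc hδ hx

theorem integral_pieceTraction {S : Set Plane} {M : ℝ} (h : IsPieceDensity σ S M)
    {c : ℝ → Plane} (hc : IsCurve c) {w : Plane} (hs : Separated c S w) :
    ∫ t in (0 : ℝ)..1, pieceTraction c S σ w t =
      ∫ y in S, kernelIntegral c (y + w) (σ y) ∂μH[1] := by
  obtain ⟨δ, hδ, hx⟩ := hs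
  have := h.isFinite
  exact integral_integral_tractionKernel h.measurableSet h.aestronglyMeasurable h.bound hc hδ hx

theorem IsPieceDensity.integrableOn_kernelIntegral {S : Set Plane} {M : ℝ}
    (h : IsPieceDensity σ S M) {c : ℝ → Plane} (hc : IsCurve c) {w : Plane}
    (hs : Separated c S w) :
    IntegrableOn (fun y => kernelIntegral c (y + w) (σ y)) S μH[1] := by
  obtain ⟨δ, hδ, hx⟩ := hs
  have := h.isFinite
  exact StokesCell.integrableOn_kernelIntegral h.measurableSet h.aestronglyMeasurable h.bound
    hc hδ hx

theorem IsPieceDensity.integrableOn_tractionKernel {S : Set Plane} {M : ℝ}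
    (h : IsPieceDensity σ S M) {c : ℝ → Plane} {w : Plane} (hs : Separated c S w) {t : ℝ}
    (ht : t ∈ Icc (0 : ℝ) 1) (n : Plane) :
    IntegrableOn (fun y => tractionKernel (c t) n (y + w) (σ y)) S μH[1] := by
  obtain ⟨δ, hδ, hx⟩ := hs
  have := h.isFinite
  exact StokesCell.integrableOn_tractionKernel h.measurableSet h.aestronglyMeasurable h.bound hδ
    (hx t ht) n

theorem nearTraction_smul (Γ : Set Plane) (x : Plane) (a : ℝ) (n : Plane) :
    nearTraction e₁ e₂ Γ σ x (a • n) = a • nearTraction e₁ e₂ Γ σ x n := by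
  simp only [nearTraction, nearSum, tractionKernel_smul, ← smul_finsum, integral_smul]

theorem singleLayerTraction_smul (Γ : Set Plane) (x : Plane) (a : ℝ) (n : Plane) :
    singleLayerTraction Γ σ x (a • n) = a • singleLayerTraction Γ σ x n := by
  simp only [singleLayerTraction, tractionKernel_smul, integral_smul]

theorem nearTraction_eq (he : 0 < cross e₁ e₂) (hΩ : IsParticle e₁ e₂ Ω) {M : ℝ}
    (hM : ∀ i, IsPieceDensity σ (piece e₁ e₂ (frontier Ω) i) M) {c : ℝ → Plane}
    (hs : ∀ i a b, Separated c (piece e₁ e₂ (frontier Ω) i) (imageVec e₁ e₂ i a b))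
    {t : ℝ} (ht : t ∈ Icc (0 : ℝ) 1) :
    nearTraction e₁ e₂ (frontier Ω) σ (c t) (perp (deriv c t)) =
      ∑ i, ((pieceTraction c (piece e₁ e₂ (frontier Ω) i) σ (imageVec e₁ e₂ i 0 0) t +
          pieceTraction c (piece e₁ e₂ (frontier Ω) i) σ (imageVec e₁ e₂ i 1 0) t) +
        (pieceTraction c (piece e₁ e₂ (frontier Ω) i) σ (imageVec e₁ e₂ i 0 1) t +
          pieceTraction c (piece e₁ e₂ (frontier Ω) i) σ (imageVec e₁ e₂ i 1 1) t)) := by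
  have hintg := fun i a b =>
    (hM i).integrableOn_tractionKernel (hs i a b) ht (perp (deriv c t))
  have hsum := fun i => ((hintg i 0 0).add (hintg i 1 0)).add ((hintg i 0 1).add (hintg i 1 1))
  have hcongr : ∀ i, EqOn (fun y => nearSum e₁ e₂
      (fun z => tractionKernel (c t) (perp (deriv c t)) z (σ y)) y) _
      (piece e₁ e₂ (frontier Ω) i) := fun i y hy => nearSum_piece he hΩ _ hy
  rw [nearTraction]
  conv_lhs => rw [← iUnion_piece (e₁ := e₁) (e₂ := e₂) (frontier Ω)]
  rw [integral_iUnion_fintype (fun i => (hM i).measurableSet) (pairwise_disjoint_piece _)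
    fun i => (hsum i).congr_fun (hcongr i).symm (hM i).measurableSet]
  refine Finset.sum_congr rfl fun i _ => ?_
  rw [setIntegral_congr_fun (hM i).measurableSet (hcongr i),
    integral_add_four (hintg i 0 0) (hintg i 1 0) (hintg i 0 1) (hintg i 1 1)]
  rfl

/-- The pieces of the shifted boundary do not overlap. -/
theorem IsParticle.pairwise_disjoint_shifted (hΩ : IsParticle e₁ e₂ Ω) :
    Pairwise (Function.onFun Disjoint fun i =>
      (fun y => y - pieceShift e₁ e₂ i) '' piece e₁ e₂ (frontier Ω) i) := by
  intro i j hij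
  rw [Function.onFun, Set.disjoint_left]
  rintro _ ⟨y, hy, rfl⟩ ⟨y', hy', heq⟩
  simp only at heq
  refine hΩ.disjoint_images ((pieceIndex j).1 - (pieceIndex i).1)
    ((pieceIndex j).2 - (pieceIndex i).2) (fun h0 => hij (pieceIndex_injective ?_)) y
    (frontier_subset_closure hy.1) ?_
  · rw [Prod.mk.injEq] at h0
    exact Prod.ext (by omega) (by omega)
  · have : y + latticeVec e₁ e₂ ((pieceIndex j).1 - (pieceIndex i).1)
        ((pieceIndex j).2 - (pieceIndex i).2) = y' := by
      rw [pieceShift_eq, pieceShift_eq] at heq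
      rw [sub_eq_iff_eq_add.1 heq]
      simp only [latticeVec]
      push_cast
      module
    rw [this]
    exact frontier_subset_closure hy'.1

theorem singleLayerTraction_shifted (hΩ : IsParticle e₁ e₂ Ω) {M : ℝ}
    (hM : ∀ i, IsPieceDensity σ (piece e₁ e₂ (frontier Ω) i) M) {σ' : Plane → Plane}
    (hσ' : IsShiftedDensity e₁ e₂ (frontier Ω) σ σ') {c : ℝ → Plane}
    (hs : ∀ i, Separated c (piece e₁ e₂ (frontier Ω) i) (imageVec e₁ e₂ i 0 0))
    {t : ℝ} (ht : t ∈ Icc (0 : ℝ) 1) :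
    singleLayerTraction (shiftedBoundary e₁ e₂ (frontier Ω)) σ' (c t) (perp (deriv c t)) =
      ∑ i, pieceTraction c (piece e₁ e₂ (frontier Ω) i) σ (imageVec e₁ e₂ i 0 0) t := by
  have hintg := fun i => (hM i).integrableOn_tractionKernel (hs i) ht (perp (deriv c t))
  have hcongr : ∀ i, EqOn (fun y => tractionKernel (c t) (perp (deriv c t))
      (y - pieceShift e₁ e₂ i) (σ' (y - pieceShift e₁ e₂ i)))
      (fun y => tractionKernel (c t) (perp (deriv c t)) (y + imageVec e₁ e₂ i 0 0) (σ y))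
      (piece e₁ e₂ (frontier Ω) i) := fun i y hy => by
    simp [hσ' i y hy, add_imageVec]
  have hmp : ∀ i, MeasurePreserving (fun y : Plane => y - pieceShift e₁ e₂ i) μH[1] μH[1] :=
    fun i => (IsometryEquiv.subRight (pieceShift e₁ e₂ i)).measurePreserving_hausdorffMeasure 1
  have hemb : ∀ i, MeasurableEmbedding (fun y : Plane => y - pieceShift e₁ e₂ i) :=
    fun i => (IsometryEquiv.subRight
      (pieceShift e₁ e₂ i)).toHomeomorph.isClosedEmbedding.measurableEmbedding
  rw [singleLayerTraction, shiftedBoundary, integral_iUnion_fintype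
    (fun i => (hemb i).measurableSet_image.2 (hM i).measurableSet) hΩ.pairwise_disjoint_shifted]
  · refine Finset.sum_congr rfl fun i _ => ?_
    rw [(hmp i).setIntegral_image_emb (hemb i), setIntegral_congr_fun (hM i).measurableSet
      (hcongr i)]
    rfl
  · intro i
    rw [(hmp i).integrableOn_image (hemb i)]
    exact (hintg i).congr_fun (hcongr i).symm (hM i).measurableSet

theorem tractionIntegral_shifted (hΩ : IsParticle e₁ e₂ Ω) {M : ℝ}
    (hM : ∀ i, IsPieceDensity σ (piece e₁ e₂ (frontier Ω) i) M) {σ' : Plane → Plane}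
    (hσ' : IsShiftedDensity e₁ e₂ (frontier Ω) σ σ') {c : ℝ → Plane} (hc : IsCurve c)
    (hs : ∀ i, Separated c (piece e₁ e₂ (frontier Ω) i) (imageVec e₁ e₂ i 0 0)) :
    tractionIntegral c (singleLayerTraction (shiftedBoundary e₁ e₂ (frontier Ω)) σ') =
      ∑ i, ∫ y in piece e₁ e₂ (frontier Ω) i,
        kernelIntegral c (y + imageVec e₁ e₂ i 0 0) (σ y) ∂μH[1] := by
  rw [tractionIntegral_eq c (singleLayerTraction_smul _)]
  have h1 : ∫ t in (0 : ℝ)..1, singleLayerTraction (shiftedBoundary e₁ e₂ (frontier Ω)) σ' (c t)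
      (perp (deriv c t)) = ∫ t in (0 : ℝ)..1, ∑ i, pieceTraction c
        (piece e₁ e₂ (frontier Ω) i) σ (imageVec e₁ e₂ i 0 0) t := by
    refine intervalIntegral.integral_congr fun t ht => ?_
    rw [uIcc_of_le zero_le_one] at ht
    exact singleLayerTraction_shifted hΩ hM hσ' hs ht
  rw [h1, intervalIntegral.integral_finsetSum
    fun i _ => intervalIntegrable_pieceTraction (hM i) hc (hs i)]
  exact Finset.sum_congr rfl fun i _ => integral_pieceTraction (hM i) hc (hs i)

theorem intervalIntegrable_nearTraction (he : 0 < cross e₁ e₂) (hΩ : IsParticle e₁ e₂ Ω) {M : ℝ}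
    (hM : ∀ i, IsPieceDensity σ (piece e₁ e₂ (frontier Ω) i) M) {c : ℝ → Plane} (hc : IsCurve c)
    (hs : ∀ i a b, Separated c (piece e₁ e₂ (frontier Ω) i) (imageVec e₁ e₂ i a b)) :
    IntervalIntegrable (fun t => nearTraction e₁ e₂ (frontier Ω) σ (c t) (perp (deriv c t)))
      volume 0 1 := by
  have hi := fun i a b => intervalIntegrable_pieceTraction (hM i) hc (hs i a b)
  refine (IntervalIntegrable.sum Finset.univ fun i _ =>
    ((hi i 0 0).add (hi i 1 0)).add ((hi i 0 1).add (hi i 1 1))).congr fun t ht => ?_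
  rw [uIoc_of_le zero_le_one] at ht
  rw [nearTraction_eq he hΩ hM hs (Ioc_subset_Icc_self ht)]
  simp

theorem integral_nearTraction (he : 0 < cross e₁ e₂) (hΩ : IsParticle e₁ e₂ Ω) {M : ℝ}
    (hM : ∀ i, IsPieceDensity σ (piece e₁ e₂ (frontier Ω) i) M) {c : ℝ → Plane} (hc : IsCurve c)
    (hs : ∀ i a b, Separated c (piece e₁ e₂ (frontier Ω) i) (imageVec e₁ e₂ i a b)) :
    ∫ t in (0 : ℝ)..1, nearTraction e₁ e₂ (frontier Ω) σ (c t) (perp (deriv c t)) =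
      ∑ i, ∫ y in piece e₁ e₂ (frontier Ω) i,
        ((kernelIntegral c (y + imageVec e₁ e₂ i 0 0) (σ y) +
          kernelIntegral c (y + imageVec e₁ e₂ i 1 0) (σ y)) +
        (kernelIntegral c (y + imageVec e₁ e₂ i 0 1) (σ y) +
          kernelIntegral c (y + imageVec e₁ e₂ i 1 1) (σ y))) ∂μH[1] := by
  have hi := fun i a b => intervalIntegrable_pieceTraction (hM i) hc (hs i a b)
  have hk := fun i a b => (hM i).integrableOn_kernelIntegral hc (hs i a b)
  have h1 := intervalIntegral.integral_congr (μ := volume) (a := (0 : ℝ)) (b := 1)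
    fun t ht => nearTraction_eq he hΩ hM hs (by rwa [uIcc_of_le zero_le_one] at ht)
  refine h1.trans ?_
  rw [intervalIntegral.integral_finsetSum fun i _ =>
    ((hi i 0 0).add (hi i 1 0)).add ((hi i 0 1).add (hi i 1 1))]
  refine Finset.sum_congr rfl fun i _ => ?_
  rw [integral_add_four (hk i 0 0) (hk i 1 0) (hk i 0 1) (hk i 1 1),
    intervalIntegral.integral_of_le zero_le_one, integral_add_four (hi i 0 0).1 (hi i 1 0).1
      (hi i 0 1).1 (hi i 1 1).1]
  simp only [← intervalIntegral.integral_of_le zero_le_one]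
  simp only [integral_pieceTraction (hM i) hc (hs i _ _)]

end

/-! ### Separation of sources and targets -/

section

variable {e₁ e₂ : Plane} {Ω : Set Plane} {σ : Plane → Plane}

theorem IsPiecewiseC1.isCurve {c : ℝ → Plane} (hc : IsPiecewiseC1 c) : IsCurve c := by
  obtain ⟨h1, ⟨P, hP, hd⟩, h3⟩ := hc
  exact ⟨h1, ⟨P, hP.countable, fun t ht => (hd t ht).differentiableAt one_ne_zero⟩, h3⟩

/-- The four shifted walls. -/
def shiftedWalls (e₁ e₂ : Plane) : Set (ℝ → Plane) :=
  {shiftCurve (wallR e₁ e₂) e₂, shiftCurve (wallL e₁ e₂) (e₁ + e₂),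
    shiftCurve (wallD e₁ e₂) (e₁ + e₂), shiftCurve (wallD e₁ e₂) e₂}

theorem isCurve_of_mem_shiftedWalls {b : ℝ → Plane} (hb : b ∈ shiftedWalls e₁ e₂) :
    IsCurve b := by
  rcases hb with rfl | rfl | rfl | rfl <;> exact isCurve_shiftCurve (isCurve_seg _ _) _

theorem half_le_max_coord (he : 0 < cross e₁ e₂) {b : ℝ → Plane} (hb : b ∈ shiftedWalls e₁ e₂)
    {t : ℝ} {z : Plane} (hzA : coordA e₁ e₂ z ∈ Ico (-1 : ℝ) 0)
    (hzB : coordB e₁ e₂ z ∈ Ico (-1 : ℝ) 0) :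
    1 / 2 ≤ max |coordA e₁ e₂ (b t - z)| |coordB e₁ e₂ (b t - z)| := by
  have hA1 := coordA_e₁ he
  have hB2 := coordB_e₂ he
  have hA2 : coordA e₁ e₂ e₂ = 0 := coordA_e₂
  have hB1 : coordB e₁ e₂ e₁ = 0 := coordB_e₁
  have hAc := coordA_corner he
  have hBc := coordB_corner he
  rcases hb with rfl | rfl | rfl | rfl
  · refine le_max_of_le_left (le_abs.2 (Or.inl ?_))
    simp only [shiftCurve, wallR, seg, coordA_add, coordA_sub, coordA_smul, hA1, hA2, hAc]
    linarith [hzA.2]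
  · refine le_max_of_le_left (le_abs.2 (Or.inr ?_))
    simp only [shiftCurve, wallL, seg, coordA_add, coordA_sub, coordA_smul, hA1, hA2, hAc]
    linarith [hzA.1]
  · refine le_max_of_le_right (le_abs.2 (Or.inr ?_))
    simp only [shiftCurve, wallD, seg, coordB_add, coordB_sub, coordB_smul, hB1, hB2, hBc]
    linarith [hzB.1]
  · refine le_max_of_le_right (le_abs.2 (Or.inr ?_))
    simp only [shiftCurve, wallD, seg, coordB_add, coordB_sub, coordB_smul, hB1, hB2, hBc]
    linarith [hzB.1]

theorem exists_le_norm_of_half_le_max (e₁ e₂ : Plane) : ∃ δ > 0, ∀ r : Plane,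
    1 / 2 ≤ max |coordA e₁ e₂ r| |coordB e₁ e₂ r| → δ ≤ ‖r‖ := by
  set A := (coordALin e₁ e₂).toContinuousLinearMap with hA
  set B := (coordBLin e₁ e₂).toContinuousLinearMap with hB
  refine ⟨1 / (2 * (‖A‖ + ‖B‖ + 1)), by positivity, fun r hr => ?_⟩
  have h1 : |coordA e₁ e₂ r| ≤ ‖A‖ * ‖r‖ := A.le_opNorm r
  have h2 : |coordB e₁ e₂ r| ≤ ‖B‖ * ‖r‖ := B.le_opNorm r
  have hA0 := norm_nonneg A
  have hB0 := norm_nonneg B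
  have hr0 := norm_nonneg r
  rw [div_le_iff₀ (by positivity)]
  have h3 : max |coordA e₁ e₂ r| |coordB e₁ e₂ r| ≤ ‖r‖ * (‖A‖ + ‖B‖ + 1) := by
    apply max_le <;> nlinarith
  linarith

theorem separated_shiftedWall (he : 0 < cross e₁ e₂) (hΩ : IsParticle e₁ e₂ Ω) {b : ℝ → Plane}
    (hb : b ∈ shiftedWalls e₁ e₂) (i : Fin 4) :
    Separated b (piece e₁ e₂ (frontier Ω) i) (imageVec e₁ e₂ i 0 0) := by
  obtain ⟨δ, hδ, h⟩ := exists_le_norm_of_half_le_max e₁ e₂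
  refine ⟨δ, hδ, fun t _ y hy => h _ ?_⟩
  obtain ⟨hA, hB⟩ := mem_quadrant_shift he (hΩ.frontier_subset hy.1) hy.2
  have : y + imageVec e₁ e₂ i 0 0 = y - pieceShift e₁ e₂ i := by simp [add_imageVec]
  rw [this]
  exact half_le_max_coord he hb hA hB

theorem IsDeformedBottomWall.not_mem {c : ℝ → Plane} (hc : IsDeformedBottomWall e₁ e₂ Ω c)
    {y : Plane} (hy : y ∈ closure Ω) (k : ℤ) : y + latticeVec e₁ e₂ 0 k ∉ periodicCurve e₁ c := by
  rcases le_or_gt 0 k with hk | hk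
  · exact (hc.above k hk y hy).not_mem
  · exact (hc.below k hk y hy).not_mem

theorem separated_deformedBottomWall (hΩ : IsParticle e₁ e₂ Ω) {c : ℝ → Plane}
    (hc : IsDeformedBottomWall e₁ e₂ Ω c) (i : Fin 4) (a b : ℤ) :
    Separated c (piece e₁ e₂ (frontier Ω) i) (imageVec e₁ e₂ i a b) := by
  have hK : IsCompact (Icc (0 : ℝ) 1 ×ˢ frontier Ω) := isCompact_Icc.prod hΩ.boundary.isCompact
  have hcont : ContinuousOn (fun p : ℝ × Plane => ‖c p.1 - (p.2 + imageVec e₁ e₂ i a b)‖)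
      (Icc (0 : ℝ) 1 ×ˢ frontier Ω) :=
    ((hc.piecewiseC1.1.comp continuousOn_fst fun p hp => hp.1).sub
      (continuousOn_snd.add continuousOn_const)).norm
  obtain ⟨δ, hδ, h⟩ := hK.exists_forall_le' hcont (a := 0) fun p hp => by
    rw [norm_pos_iff, sub_ne_zero]
    have := ne_of_not_mem_periodicCurve
      (hc.not_mem (frontier_subset_closure hp.2) (b - (pieceIndex i).2))
      (a - (pieceIndex i).1) hp.1
    intro heq
    apply this
    rw [heq]
    simp only [imageVec, latticeVec]
    push_cast
    module
  exact ⟨δ, hδ, fun t ht y hy => h (t, y) ⟨ht, hy.1⟩⟩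

/-! ### The identity for a single source on the boundary -/

theorem kernelIntegral_piece (he : 0 < cross e₁ e₂) (hΩ : IsParticle e₁ e₂ Ω) {c : ℝ → Plane}
    (hc : IsDeformedBottomWall e₁ e₂ Ω c)
    (hcU : ∀ t ∈ Icc (0 : ℝ) 1, c t ∈ expandedCell e₁ e₂) {i : Fin 4} {y : Plane}
    (hy : y ∈ piece e₁ e₂ (frontier Ω) i) (f : Plane) :
    (kernelIntegral c (y + imageVec e₁ e₂ i 0 0) f +
      kernelIntegral c (y + imageVec e₁ e₂ i 1 0) f) +
    (kernelIntegral c (y + imageVec e₁ e₂ i 0 1) f +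
      kernelIntegral c (y + imageVec e₁ e₂ i 1 1) f) =
    kernelIntegral (shiftCurve (wallR e₁ e₂) e₂) (y + imageVec e₁ e₂ i 0 0) f
      - kernelIntegral (shiftCurve (wallL e₁ e₂) (e₁ + e₂)) (y + imageVec e₁ e₂ i 0 0) f
      + (2 : ℝ) • kernelIntegral (shiftCurve (wallD e₁ e₂) (e₁ + e₂))
          (y + imageVec e₁ e₂ i 0 0) f
      + (2 : ℝ) • kernelIntegral (shiftCurve (wallD e₁ e₂) e₂) (y + imageVec e₁ e₂ i 0 0) f
      - (((pieceIndex i).2 : ℤ) : ℝ) • f := by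
  obtain ⟨hA, hB⟩ := mem_quadrant_shift he (hΩ.frontier_subset hy.1) hy.2
  have hyc := frontier_subset_closure hy.1
  have h0 : c 0 = corner e₁ e₂ := by simp [hc.start, wallD, seg]
  have h1 : c 1 = corner e₁ e₂ + e₁ := by simp [hc.finish, wallD, seg]
  have hz : ∀ b : ℤ, y - pieceShift e₁ e₂ i + (b : ℝ) • e₂ =
      y + latticeVec e₁ e₂ 0 (b - (pieceIndex i).2) + ((-(pieceIndex i).1 : ℤ) : ℝ) • e₁ := by
    intro b
    rw [pieceShift_eq]
    simp only [latticeVec]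
    push_cast
    module
  have hk : (pieceIndex i).2 = 0 ∨ (pieceIndex i).2 = 1 := by
    fin_cases i <;> simp [pieceIndex]
  have habove : LiesAbove e₁ e₂ c (y - pieceShift e₁ e₂ i + e₂) := by
    have := hz 1
    rw [Int.cast_one, one_smul] at this
    rw [this]
    exact (hc.above _ (by omega) y hyc).add_e₁ _
  have hz0 := hz 0
  rw [Int.cast_zero, zero_smul, add_zero] at hz0
  simp only [add_imageVec, Int.cast_zero, zero_smul, add_zero, Int.cast_one, one_smul]
  refine kernelIntegral_four_images he hc.piecewiseC1.isCurve h0 h1 (fun t ht => (hcU t ht).1)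
    hA hB habove ?_ f
  rcases hk with hk | hk
  · refine Or.inl ⟨?_, by simp [hk]⟩
    rw [hz0]
    exact (hc.above _ (by omega) y hyc).add_e₁ _
  · refine Or.inr ⟨?_, by simp [hk]⟩
    rw [hz0]
    exact (hc.below _ (by omega) y hyc).add_e₁ _

theorem netForce_upper {M : ℝ} (hM : ∀ i, IsPieceDensity σ (piece e₁ e₂ (frontier Ω) i) M) :
    ∑ i : Fin 4, (((pieceIndex i).2 : ℤ) : ℝ) • ∫ y in piece e₁ e₂ (frontier Ω) i, σ y ∂μH[1] =
      netForce (piece e₁ e₂ (frontier Ω) 0 ∪ piece e₁ e₂ (frontier Ω) 1) σ := by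
  rw [netForce, setIntegral_union (pairwise_disjoint_piece _ (by decide)) (hM 1).measurableSet
    (hM 0).integrableOn (hM 1).integrableOn, Fin.sum_univ_four]
  simp [pieceIndex]

theorem integral_wall_combination {α : Type*} [MeasurableSpace α] {ν : Measure α}
    {R L D D' f : α → Plane} (hR : Integrable R ν) (hL : Integrable L ν) (hD : Integrable D ν)
    (hD' : Integrable D' ν) (hf : Integrable f ν) (a : ℝ) :
    ∫ x, (R x - L x + (2 : ℝ) • D x + (2 : ℝ) • D' x - a • f x) ∂ν =
      ∫ x, R x ∂ν - ∫ x, L x ∂ν + (2 : ℝ) • ∫ x, D x ∂ν + (2 : ℝ) • ∫ x, D' x ∂ν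
        - a • ∫ x, f x ∂ν := by
  have h1 : Integrable (fun x => R x - L x) ν := hR.sub hL
  have h2 : Integrable (fun x => R x - L x + (2 : ℝ) • D x) ν := h1.add (hD.smul (2 : ℝ))
  have h3 : Integrable (fun x => R x - L x + (2 : ℝ) • D x + (2 : ℝ) • D' x) ν :=
    h2.add (hD'.smul (2 : ℝ))
  have h4 : Integrable (fun x => (2 : ℝ) • D x) ν := hD.smul (2 : ℝ)
  have h5 : Integrable (fun x => (2 : ℝ) • D' x) ν := hD'.smul (2 : ℝ)
  have h6 : Integrable (fun x => a • f x) ν := hf.smul a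
  rw [integral_sub h3 h6, integral_add h2 h5, integral_add h1 h4, integral_sub hR hL,
    integral_smul, integral_smul, integral_smul]

/-- The traction integral of the near sum over the deformed wall. -/
theorem tractionIntegral_near (he : 0 < cross e₁ e₂) (hΩ : IsParticle e₁ e₂ Ω) {M : ℝ}
    (hM : ∀ i, IsPieceDensity σ (piece e₁ e₂ (frontier Ω) i) M) {σ' : Plane → Plane}
    (hσ' : IsShiftedDensity e₁ e₂ (frontier Ω) σ σ') {c : ℝ → Plane}
    (hc : IsDeformedBottomWall e₁ e₂ Ω c)
    (hcU : ∀ t ∈ Icc (0 : ℝ) 1, c t ∈ expandedCell e₁ e₂) :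
    ∫ t in (0 : ℝ)..1, nearTraction e₁ e₂ (frontier Ω) σ (c t) (perp (deriv c t)) =
      tractionIntegral (shiftCurve (wallR e₁ e₂) e₂)
          (singleLayerTraction (shiftedBoundary e₁ e₂ (frontier Ω)) σ')
      - tractionIntegral (shiftCurve (wallL e₁ e₂) (e₁ + e₂))
          (singleLayerTraction (shiftedBoundary e₁ e₂ (frontier Ω)) σ')
      + (2 : ℝ) • tractionIntegral (shiftCurve (wallD e₁ e₂) (e₁ + e₂))
          (singleLayerTraction (shiftedBoundary e₁ e₂ (frontier Ω)) σ')
      + (2 : ℝ) • tractionIntegral (shiftCurve (wallD e₁ e₂) e₂)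
          (singleLayerTraction (shiftedBoundary e₁ e₂ (frontier Ω)) σ')
      - netForce (piece e₁ e₂ (frontier Ω) 0 ∪ piece e₁ e₂ (frontier Ω) 1) σ := by
  have hR : shiftCurve (wallR e₁ e₂) e₂ ∈ shiftedWalls e₁ e₂ := by simp [shiftedWalls]
  have hL : shiftCurve (wallL e₁ e₂) (e₁ + e₂) ∈ shiftedWalls e₁ e₂ := by simp [shiftedWalls]
  have hD : shiftCurve (wallD e₁ e₂) (e₁ + e₂) ∈ shiftedWalls e₁ e₂ := by simp [shiftedWalls]
  have hD' : shiftCurve (wallD e₁ e₂) e₂ ∈ shiftedWalls e₁ e₂ := by simp [shiftedWalls]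
  have hwall : ∀ b ∈ shiftedWalls e₁ e₂, tractionIntegral b
      (singleLayerTraction (shiftedBoundary e₁ e₂ (frontier Ω)) σ') =
      ∑ i, ∫ y in piece e₁ e₂ (frontier Ω) i,
        kernelIntegral b (y + imageVec e₁ e₂ i 0 0) (σ y) ∂μH[1] := fun b hb =>
    tractionIntegral_shifted hΩ hM hσ' (isCurve_of_mem_shiftedWalls hb)
      (separated_shiftedWall he hΩ hb)
  have hintg : ∀ b ∈ shiftedWalls e₁ e₂, ∀ i, IntegrableOn
      (fun y => kernelIntegral b (y + imageVec e₁ e₂ i 0 0) (σ y))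
      (piece e₁ e₂ (frontier Ω) i) μH[1] := fun b hb i =>
    (hM i).integrableOn_kernelIntegral (isCurve_of_mem_shiftedWalls hb)
      (separated_shiftedWall he hΩ hb i)
  rw [integral_nearTraction he hΩ hM hc.piecewiseC1.isCurve (separated_deformedBottomWall hΩ hc),
    hwall _ hR, hwall _ hL, hwall _ hD, hwall _ hD', ← netForce_upper hM, Finset.smul_sum,
    Finset.smul_sum, ← Finset.sum_sub_distrib, ← Finset.sum_add_distrib, ← Finset.sum_add_distrib,
    ← Finset.sum_sub_distrib]
  refine Finset.sum_congr rfl fun i _ => ?_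
  rw [setIntegral_congr_fun (hM i).measurableSet
    fun y hy => kernelIntegral_piece he hΩ hc hcU hy (σ y)]
  exact integral_wall_combination (hintg _ hR i) (hintg _ hL i) (hintg _ hD i) (hintg _ hD' i)
    (hM i).integrableOn _

theorem mem_cell_wallD (he : 0 < cross e₁ e₂) {t : ℝ} (ht : t ∈ Icc (0 : ℝ) 1) :
    wallD e₁ e₂ t ∈ cell e₁ e₂ := by
  simp only [cell, mem_ofPred_eq, wallD, seg, coordA_add, coordB_add, coordA_smul, coordB_smul,
    coordA_corner he, coordB_corner he, coordA_e₁ he, coordB_e₁]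
  exact ⟨abs_le.2 ⟨by linarith [ht.1], by linarith [ht.2]⟩, abs_le.2 ⟨by linarith, by linarith⟩⟩

end

end StokesCell

end

theorem mainTheorem6 (μ : ℝ) (hμ : 0 < μ) (e₁ e₂ : Plane) (he : 0 < cross e₁ e₂)
    (Ω : Set Plane) (hΩ : IsParticle e₁ e₂ Ω) (Γ : Set Plane) (hΓ : Γ = frontier Ω)
    (σ : Plane → Plane) (hσ : ContinuousOn σ Γ)
    (W : Set Plane) (hWo : IsOpen W) (hWc : Convex ℝ W)
    (hUW : cell e₁ e₂ ⊆ W) (hWU : W ⊆ expandedCell e₁ e₂)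
    (v : Plane → Plane) (q : Plane → ℝ) (hvq : IsCorrectionPair μ e₁ e₂ Γ σ W v q)
    (c : ℝ → Plane) (hc : IsDeformedBottomWall e₁ e₂ Ω c)
    (hcW : ∀ t ∈ Set.Icc (0 : ℝ) 1, c t ∈ W)
    (Γ' : Set Plane) (hΓ' : Γ' = shiftedBoundary e₁ e₂ Γ)
    (σ' : Plane → Plane) (hσ' : IsShiftedDensity e₁ e₂ Γ σ σ') :
    (tractionIntegral c (periodicTraction μ e₁ e₂ Γ σ v q) =
      tractionIntegral (shiftCurve (wallR e₁ e₂) e₂) (singleLayerTraction Γ' σ')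
      - tractionIntegral (shiftCurve (wallL e₁ e₂) (e₁ + e₂)) (singleLayerTraction Γ' σ')
      + (2 : ℝ) • tractionIntegral (shiftCurve (wallD e₁ e₂) (e₁ + e₂)) (singleLayerTraction Γ' σ')
      + (2 : ℝ) • tractionIntegral (shiftCurve (wallD e₁ e₂) e₂) (singleLayerTraction Γ' σ')
      - netForce (piece e₁ e₂ Γ 0 ∪ piece e₁ e₂ Γ 1) σ
      + tractionIntegral (wallD e₁ e₂) (traction μ v q)) ∧
    (∀ b ∈ ({shiftCurve (wallR e₁ e₂) e₂, shiftCurve (wallL e₁ e₂) (e₁ + e₂),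
        shiftCurve (wallD e₁ e₂) (e₁ + e₂), shiftCurve (wallD e₁ e₂) e₂} : Set (ℝ → Plane)),
      ∀ t ∈ Set.Icc (0 : ℝ) 1, ∀ y ∈ Γ',
        1 / 2 ≤ max |coordA e₁ e₂ (b t - y)| |coordB e₁ e₂ (b t - y)|) := by
  subst hΓ hΓ'
  have hcurve := hc.piecewiseC1.isCurve
  obtain ⟨M, hM⟩ := hΩ.exists_isPieceDensity hσ
  refine ⟨?_, fun b hb t _ z hz => ?_⟩
  · rw [tractionIntegral_eq c fun x a n => by
        rw [periodicTraction, periodicTraction, nearTraction_smul, traction_smul, smul_add],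
      tractionIntegral_eq (wallD e₁ e₂) (traction_smul μ v q),
      ← tractionIntegral_near he hΩ hM hσ' hc fun t ht => hWU (hcW t ht),
      ← hvq.stokes.integral_eq hWo hWc hcurve hcW (c' := wallD e₁ e₂) (isCurve_seg _ _)
        (fun t ht => hUW (mem_cell_wallD he ht)) hc.start hc.finish]
    exact intervalIntegral.integral_add
      (intervalIntegrable_nearTraction he hΩ hM hcurve (separated_deformedBottomWall hΩ hc))
      (hvq.stokes.intervalIntegrable hWo hcurve hcW)
  · obtain ⟨i, y, hy, rfl⟩ := Set.mem_iUnion.1 hz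
    obtain ⟨hA, hB⟩ := mem_quadrant_shift he (hΩ.frontier_subset hy.1) hy.2
    exact half_le_max_coord he hb hA hB
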